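/- Let $1\le k\le n$ be integers. Let $\Lambda^k(\mathbb R^n)$ be the space of $k$-vectors with the inner product determined by $(u_1\wedge\dots\wedge u_k)\cdot(v_1\wedge\dots\wedge v_k)=\det(u_i\cdot v_j)$, let $\hat\Lambda^k_u(\mathbb R^n)$ be the set of unit simple $k$-vectors, and for $\omega=v_1\wedge\dots\wedge v_k\in\hat\Lambda^k_u(\mathbb R^n)$ let $[\omega]=\operatorname{span}\{v_1,\dots,v_k\}$. Put $$\mathcal W=\{(a,\omega)\in\mathbb R^n\times\hat\Lambda^k_u(\mathbb R^n): |a|=1,\ a\in[\omega]^\perp\},\qquad \mathbb R^+=(0,\infty),\qquad N=n+k(n-k)+1 .$$ Let $\mathcal M\subset\mathbb R^n$ be a bounded $k$-dimensional embedded $C^1$ submanifold whose closure $\overline{\mathcal M}$ is an embedded $C^1$ manifold with boundary, with interior $\mathcal M$ and (possibly empty) boundary $\partial\mathcal M=\overline{\mathcal M}\setminus\mathcal M$. For each $z\in\mathcal M$ let $\mathrm{vol}_{\mathcal M}(z)\in\hat\Lambda^k_u(\mathbb R^n)$ satisfy $[\mathrm{vol}_{\mathcal M}(z)]=T_z\mathcal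 M$ (no continuity in $z$ and no orientability is assumed). Define $$\Xi(z,a,\omega,\xi,r)=(z+\xi a,\omega,r)\in\mathbb R^n\times\hat\Lambda^k_u(\mathbb R^n)\times\mathbb R^+,\qquad (z,a,\omega,\xi,r)\in\mathcal M\times\mathcal W\times\mathbb R^+\times\mathbb R^+ .$$ Let $\mathcal H^N$ denote the $N$-dimensional Hausdorff measure for the Euclidean product metrics on $\mathbb R^n\times\mathbb R^n\times\Lambda^k(\mathbb R^n)\times\mathbb R\times\mathbb R$ and on $\mathbb R^n\times\Lambda^k(\mathbb R^n)\times\mathbb R$. Let $\mathcal A\subseteq\mathcal M\times\mathcal W\times\mathbb R^+\times\mathbb R^+$ be $\mathcal H^N$-measurable and let $f:\Xi(\mathcal A)\to\mathbb R$ be $\mathcal H^N$-integrable. Then $\{q\in\mathcal A:\Xi(q)=(p,\omega,r)\}$ is finite for $\mathcal H^N$-a.e. $(p,\omega,r)\in\Xi(\mathcal A)$, and $$\int_{\Xi(\mathcal A)}\Big[\sum_{q\in\mathcal A,\ \Xi(q)=(p,\omega,r)}f(p,\omega,r)\Big]\,d\mathcal H^{N}(p,\omega,r)=\int_{\mathcal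 A}f(z+\xi a,\omega,r)\,\frac{\xi^{\,n-k-1}}{2^{k/2}}\,\big|\mathrm{vol}_{\mathcal M}(z)\cdot\omega\big|\,d\mathcal H^{N}(z,a,\omega,\xi,r),$$ in the sense that the integrand on the left is integrable over $\Xi(\mathcal A)$ if and only if the integrand on the right is integrable over $\mathcal A$, and in that case the two integrals are equal. -/

import Mathlib

open scoped MeasureTheory

namespace FracMeasure

noncomputable section

/-- `ℝⁿ` with the Euclidean norm. -/
abbrev Vec (n : ℕ) : Type := EuclideanSpace ℝ (Fin n)

/-- The space `Λᵏ(ℝⁿ)` of `k`-vectors. Its inner product is Mathlib's, determined by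
`⟪u₁ ∧ ⋯ ∧ u_k, v₁ ∧ ⋯ ∧ v_k⟫ = det (u_i · v_j)`. -/
abbrev KVec (n k : ℕ) : Type := ⋀[ℝ]^k (Vec n)

instance (n k : ℕ) : MeasurableSpace (KVec n k) := borel _

instance (n k : ℕ) : BorelSpace (KVec n k) := ⟨rfl⟩

/-- The simple `k`-vector `v₁ ∧ ⋯ ∧ v_k`. -/
def wedge {n k : ℕ} (v : Fin k → Vec n) : KVec n k := exteriorPower.ιMulti ℝ k v

theorem inner_wedge_wedge {n k : ℕ} (u v : Fin k → Vec n) :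
    inner ℝ (wedge u) (wedge v) = (Matrix.of fun i j => inner ℝ (u i) (v j)).det := by
  rw [wedge, wedge, exteriorPower.inner_ιMulti_ιMulti, ← Matrix.det_transpose]
  rfl

/-- The simple `k`-vectors of unit length. -/
def unitSimple (n k : ℕ) : Set (KVec n k) := {ω | (∃ v, wedge v = ω) ∧ ‖ω‖ = 1}

/-- The subspace `[ω]` of a non-zero simple `k`-vector `ω`: the span of the vectors `v_i` in a
representation `ω = v₁ ∧ ⋯ ∧ v_k`. It does not depend on the representation (see `space_wedge`),
so that the intersection over all representations is the span for any one of them. -/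
def space {n k : ℕ} (ω : KVec n k) : Submodule ℝ (Vec n) :=
  ⨅ v : {v : Fin k → Vec n // wedge v = ω}, Submodule.span ℝ (Set.range v.1)

theorem wedge_ne_zero_iff {n k : ℕ} (v : Fin k → Vec n) :
    wedge v ≠ 0 ↔ LinearIndependent ℝ v := by
  rw [← Matrix.det_gram_ne_zero_iff_linearIndependent (𝕜 := ℝ), ← exteriorPower.inner_ιMulti_self,
    inner_self_ne_zero]
  rfl

theorem span_le_of_wedge_eq {n k : ℕ} {v w : Fin k → Vec n} (hv : wedge v ≠ 0)
    (h : wedge w = wedge v) :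
    Submodule.span ℝ (Set.range w) ≤ Submodule.span ℝ (Set.range v) := by
  rw [Submodule.span_le]
  rintro _ ⟨j, rfl⟩
  by_contra hj
  have hli : LinearIndependent ℝ (Fin.cons (w j) v : Fin (k + 1) → Vec n) :=
    linearIndependent_finCons.2 ⟨(wedge_ne_zero_iff v).1 hv, hj⟩
  have h' : ExteriorAlgebra.ιMulti ℝ k w = ExteriorAlgebra.ιMulti ℝ k v := congrArg Subtype.val h
  refine (wedge_ne_zero_iff _).2 hli (Subtype.ext ?_)
  calc ExteriorAlgebra.ιMulti ℝ (k + 1) (Fin.cons (w j) v : Fin (k + 1) → Vec n)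
      = ExteriorAlgebra.ιMulti ℝ (k + 1) (Fin.cons (w j) w : Fin (k + 1) → Vec n) := by
        rw [ExteriorAlgebra.ιMulti_succ_apply, ExteriorAlgebra.ιMulti_succ_apply]
        simp only [Fin.cons_zero, Matrix.vecTail, Function.comp_def, Fin.cons_succ]
        exact congrArg _ h'.symm
    _ = 0 := ExteriorAlgebra.ιMulti_eq_zero_of_not_inj fun hinj =>
        absurd (@hinj 0 j.succ (by simp)) (Fin.succ_ne_zero j).symm

theorem space_wedge {n k : ℕ} {v : Fin k → Vec n} (hv : wedge v ≠ 0) :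
    space (wedge v) = Submodule.span ℝ (Set.range v) :=
  le_antisymm (iInf_le_of_le ⟨v, rfl⟩ le_rfl)
    (le_iInf fun w => span_le_of_wedge_eq (by rw [w.2]; exact hv) w.2.symm)

/-- The set `𝒲` lives in this space: pairs `(a, ω)` with the Euclidean product norm. -/
abbrev Dir (n k : ℕ) : Type := WithLp 2 (Vec n × KVec n k)

/-- The ambient Euclidean space of the parameters `(z, (a, ω), (ξ, r))`. -/
abbrev Param (n k : ℕ) : Type := WithLp 2 (Vec n × WithLp 2 (Dir n k × WithLp 2 (ℝ × ℝ)))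

namespace Param

variable {n k : ℕ}

/-- The point `z` of the manifold. -/
def z (q : Param n k) : Vec n := q.fst

/-- The pair `(a, ω)`. -/
def dir (q : Param n k) : Dir n k := q.snd.fst

/-- The direction `a`. -/
def a (q : Param n k) : Vec n := q.dir.fst

/-- The `k`-vector `ω`. -/
def ω (q : Param n k) : KVec n k := q.dir.snd

/-- The distance `ξ`. -/
def ξ (q : Param n k) : ℝ := q.snd.snd.fst

/-- The radius `r`. -/
def r (q : Param n k) : ℝ := q.snd.snd.snd

end Param

/-- The ambient Euclidean space of the disks `(p, ω, r)` with centre `p`, unit simple normal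
`k`-vector `ω` and radius `r`. -/
abbrev Disk (n k : ℕ) : Type := WithLp 2 (Vec n × WithLp 2 (KVec n k × ℝ))

/-- The set `𝒲` of the pairs `(a, ω)` of a unit vector `a` and a unit simple `k`-vector `ω` with
`a ∈ [ω]ᗮ`. -/
def W (n k : ℕ) : Set (Dir n k) :=
  {w | ‖w.fst‖ = 1 ∧ w.snd ∈ unitSimple n k ∧ w.fst ∈ (space w.snd)ᗮ}

/-- The set `M × 𝒲 × ℝ⁺ × ℝ⁺`, where `ℝ⁺ = (0, ∞)`. -/
def paramSet {n : ℕ} (k : ℕ) (M : Set (Vec n)) : Set (Param n k) :=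
  {q | q.z ∈ M ∧ q.dir ∈ W n k ∧ 0 < q.ξ ∧ 0 < q.r}

/-- The map `Ξ(z, a, ω, ξ, r) = (z + ξ a, ω, r)`. -/
def Xi {n k : ℕ} (q : Param n k) : Disk n k :=
  WithLp.toLp 2 (q.z + q.ξ • q.a, WithLp.toLp 2 (q.ω, q.r))

/-- `M` is a bounded `k`-dimensional manifold in `ℝⁿ` whose closure is a manifold with boundary,
the interior being `M` and the boundary `∂M = closure M \ M` (which may be empty). Around each of
its points `M` is straightened to the `k`-dimensional coordinate subspace, and around each point of
`∂M` the closure of `M` is straightened to a closed `k`-dimensional coordinate half-space with `∂M`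
on its edge, by a `C¹` diffeomorphism between open subsets of `ℝⁿ`. -/
structure IsBoundedManifold {n : ℕ} (k : ℕ) (M : Set (Vec n)) : Prop where
  bounded : Bornology.IsBounded M
  interior_chart : ∀ z ∈ M, ∃ Φ : OpenPartialHomeomorph (Vec n) (Vec n),
    z ∈ Φ.source ∧ ContDiffOn ℝ 1 Φ Φ.source ∧ ContDiffOn ℝ 1 Φ.symm Φ.target ∧
    ∀ y ∈ Φ.source, y ∈ M ↔ ∀ i : Fin n, k ≤ (i : ℕ) → Φ y i = 0
  boundary_chart : ∀ z ∈ closure M \ M, ∃ Φ : OpenPartialHomeomorph (Vec n) (Vec n),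
    z ∈ Φ.source ∧ ContDiffOn ℝ 1 Φ Φ.source ∧ ContDiffOn ℝ 1 Φ.symm Φ.target ∧
    (∀ y ∈ Φ.source, y ∈ closure M ↔
      (∀ i : Fin n, k ≤ (i : ℕ) → Φ y i = 0) ∧ ∀ i : Fin n, (i : ℕ) = 0 → 0 ≤ Φ y i) ∧
    ∀ y ∈ Φ.source, y ∈ M ↔
      (∀ i : Fin n, k ≤ (i : ℕ) → Φ y i = 0) ∧ ∀ i : Fin n, (i : ℕ) = 0 → 0 < Φ y i

/-- The tangent space `T_z M`: the velocities at `z` of the curves in `M` through `z`. -/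
def tangentSet {n : ℕ} (M : Set (Vec n)) (z : Vec n) : Set (Vec n) :=
  {v | ∃ γ : ℝ → Vec n, γ 0 = z ∧ (∀ᶠ t in nhds (0 : ℝ), γ t ∈ M) ∧ HasDerivAt γ v 0}

/-- `vol` assigns to each `z ∈ M` a unit simple `k`-vector `vol z` with `[vol z] = T_z M`. Neither
orientability of `M` nor continuity of `vol` is required. -/
def IsVolumeForm {n k : ℕ} (M : Set (Vec n)) (vol : Vec n → KVec n k) : Prop :=
  ∀ z ∈ M, vol z ∈ unitSimple n k ∧ (space (vol z) : Set (Vec n)) = tangentSet M z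

end

end FracMeasure

/-!
The theorem is an area formula for the `C¹` map `Ξ` between two spaces of the same dimension `N`,
and the point is to find its Jacobian and to show that the fibres are finite.

A general part (`HasLocalJacobian`) derives the area formula from local estimates: if `Ξ` multiplies
the measure of all sets near a point `q` by nearly `J q`, and is injective there if `J q > 0`, then
the image under `Ξ` of the measure `J μ` on `A` has the multiplicity of `Ξ` on `A` as its density
(`exists_multiplicity`), so that integrability and integrals can be transported
(`integral_tsum_fiber`). The multiplicity is finite almost everywhere if `J` has finite integral
over the preimages of a countable cover of the target (`ae_finite_fiber`).

The local estimates come from charts centred at the point in question (`IsIsometricChart`). A chart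
of the parameters and one of the disks are chosen whose derivatives at the centre are isometries, so
that near the centre they preserve Hausdorff measure up to a factor near `1`. In these charts `Ξ` is
a map `g` of a Euclidean space into itself, for which Mathlib's estimates of the measure of an image
by `|det g'|` apply. Only the derivative at the centre is needed, which permits simple charts: a
plane near `[ω]` is the graph of a linear map, given by its slopes `c` over an orthonormal frame of
`[ω]`, and the direction `a` is corrected so as to stay orthogonal to that plane.

The slopes in the direction `a` move both `ω` and `a`, by orthogonal vectors of the same length, so
that they have to be scaled by `1/√2` in the chart of the parameters, but not in the chart of the
disks. This gives the factor `2 ^ (-k / 2)`. The rest of the matrix of `g'` is block triangular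
(`det_chartMapDeriv`): the motion of `z` contributes the determinant `vol z · ω` of the projection
of the tangent space to `[ω]`, and the motions of `a` orthogonal to `[ω]` contribute
`ξ ^ (n - k - 1)`.

For the finiteness of the fibres, disks with bounded centre and radius have bounded `ξ`, because `M`
is bounded. Since the charts also exist over the boundary of the manifold, where the manifold is
extended a little, the parameters with bounded `ξ` and `r` have finite measure by compactness of
the closure of `M` and of `𝒲` (`measure_paramSet_lt_top`), and the Jacobian is bounded there.
-/

namespace FracMeasure

open MeasureTheory Set Filter Topology

open scoped ENNReal NNReal

/-! ### From local measure estimates to an area formula -/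

/-- A local property which passes to subsets holds on the pieces of a countable measurable partition
(Lindelöf). -/
theorem exists_measurable_partition {α : Type*} [TopologicalSpace α] [SecondCountableTopology α]
    [MeasurableSpace α] [OpensMeasurableSpace α] {X : Set α} {P : Set α → Prop} (h0 : P ∅)
    (hmono : ∀ S T, S ⊆ T → P T → P S) (hP : ∀ q ∈ X, ∃ O ∈ 𝓝 q, P (O ∩ X)) :
    ∃ T : ℕ → Set α, (∀ i, MeasurableSet (T i)) ∧ Pairwise (Function.onFun Disjoint T) ∧
      X ⊆ ⋃ i, T i ∧ ∀ i, P (T i ∩ X) := by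
  have hP' : ∀ q, ∃ O : Set α, q ∈ X → IsOpen O ∧ q ∈ O ∧ P (O ∩ X) := by
    intro q
    by_cases hq : q ∈ X
    · obtain ⟨O, hO, h⟩ := hP q hq
      obtain ⟨U, hUO, hU, hqU⟩ := mem_nhds_iff.1 hO
      exact ⟨U, fun _ => ⟨hU, hqU, hmono _ _ (inter_subset_inter_left _ hUO) h⟩⟩
    · exact ⟨∅, fun h => absurd h hq⟩
  choose O hO using hP'
  obtain ⟨t, htX, htc, hXt⟩ := TopologicalSpace.countable_cover_nhdsWithin (s := X) (f := O)
    fun q hq => mem_nhdsWithin_of_mem_nhds ((hO q hq).1.mem_nhds (hO q hq).2.1)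
  rcases t.eq_empty_or_nonempty with rfl | hne
  · refine ⟨fun _ => ∅, fun _ => .empty, fun _ _ _ => by simp [Function.onFun], ?_, fun _ => ?_⟩
    · simpa using hXt
    · simpa using h0
  obtain ⟨s, rfl⟩ := htc.exists_eq_range hne
  have hs : ∀ i, s i ∈ X := fun i => htX (mem_range_self i)
  refine ⟨disjointed fun i => O (s i), fun i => ?_, disjoint_disjointed _, ?_, fun i => ?_⟩
  · exact MeasurableSet.disjointed (fun j => (hO _ (hs j)).1.measurableSet) i
  · rw [iUnion_disjointed]
    simpa using hXt
  · exact hmono _ _ (inter_subset_inter_left _ (disjointed_subset _ i)) (hO _ (hs i)).2.2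

/-- `J` is the Jacobian of `Ξ` on `X` with respect to the measures `μ` and `ν`: near a point `q`
of `X` the map `Ξ` multiplies the measure of every subset of `X` by nearly `J q`, and it is
injective there if `J q > 0`. The sets `B` need not be measurable. -/
structure HasLocalJacobian {α β : Type*} [TopologicalSpace α] [MeasurableSpace α]
    [MeasurableSpace β] (μ : Measure α) (ν : Measure β) (X : Set α) (Ξ : α → β) (J : α → ℝ≥0) :
    Prop where
  continuousOn : ContinuousOn J X
  measure_image_le : ∀ q ∈ X, ∀ m : ℝ≥0, J q < m →
    ∃ O ∈ 𝓝 q, ∀ B ⊆ O ∩ X, ν (Ξ '' B) ≤ m * μ B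
  le_measure_image : ∀ q ∈ X, ∀ m : ℝ≥0, m < J q →
    ∃ O ∈ 𝓝 q, InjOn Ξ (O ∩ X) ∧ ∀ B ⊆ O ∩ X, m * μ B ≤ ν (Ξ '' B)
  finite : ∀ q ∈ X, ∃ O ∈ 𝓝 q, μ (O ∩ X) < ∞

namespace HasLocalJacobian

section

variable {α β : Type*} [TopologicalSpace α] [MeasurableSpace α] [MeasurableSpace β]
  {μ : Measure α} {ν : Measure β} {X : Set α} {Ξ : α → β} {J : α → ℝ≥0}

theorem exists_nhds_lintegral_estimate (h : HasLocalJacobian μ ν X Ξ J) {ε : ℝ≥0} (hε : 0 < ε)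
    {q : α} (hq : q ∈ X) : ∃ O ∈ 𝓝 q, ∀ B ⊆ O ∩ X, MeasurableSet B →
      ν (Ξ '' B) ≤ ∫⁻ x in B, J x ∂μ + ε * μ B ∧ ∫⁻ x in B, J x ∂μ ≤ ν (Ξ '' B) + ε * μ B := by
  have hδ : 0 < ε / 2 := half_pos hε
  obtain ⟨O₁, hO₁, h₁⟩ := h.measure_image_le q hq (J q + ε / 2) (lt_add_of_pos_right _ hδ)
  obtain ⟨O₂, hO₂, h₂⟩ : ∃ O ∈ 𝓝 q, ∀ B ⊆ O ∩ X,
      ((J q - ε / 2 : ℝ≥0) : ℝ≥0∞) * μ B ≤ ν (Ξ '' B) := by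
    rcases le_or_gt (J q) (ε / 2) with hle | hlt
    · exact ⟨univ, univ_mem, fun B _ => by simp [tsub_eq_zero_of_le hle]⟩
    · obtain ⟨O, hO, -, hB⟩ := h.le_measure_image q hq (J q - ε / 2)
        (tsub_lt_self (hδ.trans hlt) hδ)
      exact ⟨O, hO, hB⟩
  obtain ⟨O₃, hO₃, h₃⟩ : ∃ O ∈ 𝓝 q, ∀ x ∈ O ∩ X, J q ≤ J x + ε / 2 ∧ J x ≤ J q + ε / 2 := by
    have hev : ∀ᶠ x in 𝓝[X] q, J q ≤ J x + ε / 2 ∧ J x ≤ J q + ε / 2 := by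
      have := (h.continuousOn q hq).eventually (Metric.ball_mem_nhds (J q) hδ)
      filter_upwards [this] with x hx
      have hx' : |(J x : ℝ) - J q| < ε / 2 := by
        simpa [NNReal.dist_eq] using hx
      rw [abs_lt] at hx'
      constructor <;> rw [← NNReal.coe_le_coe] <;> push_cast <;> linarith
    obtain ⟨O, hO, hO'⟩ := mem_nhdsWithin_iff_exists_mem_nhds_inter.1 hev
    exact ⟨O, hO, fun x hx => hO' hx⟩
  refine ⟨O₁ ∩ O₂ ∩ O₃, inter_mem (inter_mem hO₁ hO₂) hO₃, fun B hB hBm => ⟨?_, ?_⟩⟩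
  · have hB₁ : B ⊆ O₁ ∩ X := fun x hx => ⟨(hB hx).1.1.1, (hB hx).2⟩
    calc ν (Ξ '' B) ≤ (J q + ε / 2 : ℝ≥0) * μ B := h₁ B hB₁
      _ = ∫⁻ _ in B, (J q + ε / 2 : ℝ≥0) ∂μ := by simp
      _ ≤ ∫⁻ x in B, (J x + ε) ∂μ := by
        refine setLIntegral_mono' hBm fun x hx => ?_
        have := (h₃ x ⟨(hB hx).1.2, (hB hx).2⟩).1
        have h4 : J q + ε / 2 ≤ J x + ε := by
          calc J q + ε / 2 ≤ J x + ε / 2 + ε / 2 := by gcongr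
            _ = J x + ε := by rw [add_assoc, add_halves]
        exact_mod_cast h4
      _ = _ := by rw [lintegral_add_right _ measurable_const]; simp
  · have hB₂ : B ⊆ O₂ ∩ X := fun x hx => ⟨(hB hx).1.1.2, (hB hx).2⟩
    calc ∫⁻ x in B, J x ∂μ ≤ ∫⁻ _ in B, ((J q - ε / 2 : ℝ≥0) + ε : ℝ≥0∞) ∂μ := by
          refine setLIntegral_mono' hBm fun x hx => ?_
          have := (h₃ x ⟨(hB hx).1.2, (hB hx).2⟩).2
          have h4 : J x ≤ (J q - ε / 2) + ε := by
            calc J x ≤ J q + ε / 2 := this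
              _ ≤ (J q - ε / 2 + ε / 2) + ε / 2 := by gcongr; exact le_tsub_add
              _ = _ := by rw [add_assoc, add_halves]
          exact_mod_cast h4
      _ = (J q - ε / 2 : ℝ≥0) * μ B + ε * μ B := by simp [add_mul]
      _ ≤ _ := by gcongr; exact h₂ B hB₂

variable [SecondCountableTopology α] [OpensMeasurableSpace α]

theorem measure_image_le_lintegral_add (h : HasLocalJacobian μ ν X Ξ J) {ε : ℝ≥0} (hε : 0 < ε)
    {B : Set α} (hBX : B ⊆ X) (hB : MeasurableSet B) :
    ν (Ξ '' B) ≤ ∫⁻ x in B, J x ∂μ + ε * μ B := by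
  obtain ⟨T, hTm, hTd, hXT, hT⟩ := exists_measurable_partition (X := X)
    (P := fun S => ∀ B ⊆ S, MeasurableSet B → ν (Ξ '' B) ≤ ∫⁻ x in B, J x ∂μ + ε * μ B)
    (fun B hB _ => by simp [subset_empty_iff.1 hB])
    (fun S T hST hT B hB => hT B (hB.trans hST))
    (fun q hq => by
      obtain ⟨O, hO, hO'⟩ := h.exists_nhds_lintegral_estimate hε hq
      exact ⟨O, hO, fun B hB hBm => (hO' B hB hBm).1⟩)
  have hBT : B = ⋃ i, B ∩ T i := by
    rw [← inter_iUnion, inter_eq_left.2 (hBX.trans hXT)]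
  have hm : ∀ i, MeasurableSet (B ∩ T i) := fun i => hB.inter (hTm i)
  have hd : Pairwise (Function.onFun Disjoint fun i => B ∩ T i) := fun i j hij =>
    (hTd hij).mono inter_subset_right inter_subset_right
  calc ν (Ξ '' B) = ν (⋃ i, Ξ '' (B ∩ T i)) := by rw [← image_iUnion, ← hBT]
    _ ≤ ∑' i, ν (Ξ '' (B ∩ T i)) := measure_iUnion_le _
    _ ≤ ∑' i, (∫⁻ x in B ∩ T i, J x ∂μ + ε * μ (B ∩ T i)) := by
      gcongr with i
      exact hT i _ (fun x hx => ⟨hx.2, hBX hx.1⟩) (hm i)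
    _ = _ := by
      rw [ENNReal.tsum_add, ENNReal.tsum_mul_left, ← lintegral_iUnion hm hd,
        ← measure_iUnion hd hm, ← hBT]

theorem measure_image_eq_zero_of_null (h : HasLocalJacobian μ ν X Ξ J) {B : Set α} (hBX : B ⊆ X)
    (hB : μ B = 0) : ν (Ξ '' B) = 0 := by
  obtain ⟨T, -, -, hXT, hT⟩ := exists_measurable_partition (X := X)
    (P := fun S => ∀ B ⊆ S, μ B = 0 → ν (Ξ '' B) = 0)
    (fun B hB _ => by simp [subset_empty_iff.1 hB])
    (fun S T hST hT B hB => hT B (hB.trans hST))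
    (fun q hq => by
      obtain ⟨O, hO, hO'⟩ := h.measure_image_le q hq (J q + 1) (lt_add_of_pos_right _ one_pos)
      exact ⟨O, hO, fun B hB hB0 => by simpa [hB0] using hO' B hB⟩)
  have hBT : B = ⋃ i, B ∩ T i := by
    rw [← inter_iUnion, inter_eq_left.2 (hBX.trans hXT)]
  rw [hBT, image_iUnion, measure_iUnion_null_iff]
  exact fun i => hT i _ (fun x hx => ⟨hx.2, hBX hx.1⟩) (measure_mono_null inter_subset_left hB)

theorem measure_image_le_lintegral (h : HasLocalJacobian μ ν X Ξ J) {B : Set α} (hBX : B ⊆ X)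
    (hB : MeasurableSet B) (hBf : μ B < ∞) : ν (Ξ '' B) ≤ ∫⁻ x in B, J x ∂μ := by
  refine ENNReal.le_of_forall_pos_le_add fun ε hε _ => ?_
  have hpos : 0 < ε / ((μ B).toNNReal + 1) := by positivity
  refine (h.measure_image_le_lintegral_add hpos hBX hB).trans (add_le_add_right ?_ _)
  rw [← ENNReal.coe_toNNReal hBf.ne, ← ENNReal.coe_mul, ENNReal.coe_le_coe, ENNReal.toNNReal_coe,
    div_mul_eq_mul_div]
  exact div_le_of_le_mul₀ (by positivity) (by positivity) (by gcongr; exact le_self_add)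

theorem measure_image_eq_zero_of_jacobian_eq_zero (h : HasLocalJacobian μ ν X Ξ J) {B : Set α}
    (hBX : B ⊆ X) (hB : MeasurableSet B) (hJ : ∀ x ∈ B, J x = 0) : ν (Ξ '' B) = 0 := by
  obtain ⟨T, hTm, -, hXT, hT⟩ := exists_measurable_partition (X := X)
    (P := fun S => μ S < ∞) (by simp) (fun S T hST hT => (measure_mono hST).trans_lt hT) h.finite
  have hBT : B = ⋃ i, B ∩ T i := by
    rw [← inter_iUnion, inter_eq_left.2 (hBX.trans hXT)]
  rw [hBT, image_iUnion, measure_iUnion_null_iff]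
  intro i
  have hm : MeasurableSet (B ∩ T i) := hB.inter (hTm i)
  have hsub : B ∩ T i ⊆ T i ∩ X := fun x hx => ⟨hx.2, hBX hx.1⟩
  refine le_antisymm ((h.measure_image_le_lintegral (fun x hx => hBX hx.1) hm
    ((measure_mono hsub).trans_lt (hT i))).trans_eq ?_) zero_le
  rw [setLIntegral_congr_fun hm (g := fun _ => 0) (fun x hx => by simp [hJ x hx.1])]
  simp

end

section

variable {α β : Type*} [TopologicalSpace α] [PolishSpace α] [MeasurableSpace α] [BorelSpace α]
  [TopologicalSpace β] [T2Space β] [MeasurableSpace β] [BorelSpace β]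
  {μ : Measure α} {ν : Measure β} {X : Set α} {Ξ : α → β} {J : α → ℝ≥0}

theorem lintegral_le_measure_image (h : HasLocalJacobian μ ν X Ξ J) (hΞ : Continuous Ξ) {B : Set α}
    (hBX : B ⊆ X) (hB : MeasurableSet B) (hBf : μ B < ∞) (hinj : InjOn Ξ B) :
    ∫⁻ x in B, J x ∂μ ≤ ν (Ξ '' B) := by
  refine ENNReal.le_of_forall_pos_le_add fun ε hε _ => ?_
  have hpos : 0 < ε / ((μ B).toNNReal + 1) := by positivity
  have key : ∫⁻ x in B, J x ∂μ ≤ ν (Ξ '' B) + (ε / ((μ B).toNNReal + 1) : ℝ≥0) * μ B := by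
    generalize ε / ((μ B).toNNReal + 1) = ε' at hpos
    obtain ⟨T, hTm, hTd, hXT, hT⟩ := exists_measurable_partition (X := X)
      (P := fun S => ∀ B ⊆ S, MeasurableSet B → ∫⁻ x in B, J x ∂μ ≤ ν (Ξ '' B) + ε' * μ B)
      (fun B hB _ => by simp [subset_empty_iff.1 hB])
      (fun S T hST hT B hB => hT B (hB.trans hST))
      (fun q hq => by
        obtain ⟨O, hO, hO'⟩ := h.exists_nhds_lintegral_estimate hpos hq
        exact ⟨O, hO, fun B hB hBm => (hO' B hB hBm).2⟩)
    have hBT : B = ⋃ i, B ∩ T i := by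
      rw [← inter_iUnion, inter_eq_left.2 (hBX.trans hXT)]
    have hm : ∀ i, MeasurableSet (B ∩ T i) := fun i => hB.inter (hTm i)
    have hd : Pairwise (Function.onFun Disjoint fun i => B ∩ T i) := fun i j hij =>
      (hTd hij).mono inter_subset_right inter_subset_right
    have hm' : ∀ i, MeasurableSet (Ξ '' (B ∩ T i)) := fun i =>
      (hm i).image_of_continuousOn_injOn hΞ.continuousOn (hinj.mono inter_subset_left)
    have hd' : Pairwise (Function.onFun Disjoint fun i => Ξ '' (B ∩ T i)) := fun i j hij =>
      disjoint_image_image fun x hx y hy hxy =>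
        (hd hij).ne_of_mem hx hy (hinj hx.1 hy.1 hxy)
    calc ∫⁻ x in B, J x ∂μ = ∑' i, ∫⁻ x in B ∩ T i, J x ∂μ := by
          rw [← lintegral_iUnion hm hd, ← hBT]
      _ ≤ ∑' i, (ν (Ξ '' (B ∩ T i)) + ε' * μ (B ∩ T i)) := by
        gcongr with i
        exact hT i _ (fun x hx => ⟨hx.2, hBX hx.1⟩) (hm i)
      _ = _ := by
        rw [ENNReal.tsum_add, ENNReal.tsum_mul_left, ← measure_iUnion hd' hm', ← image_iUnion,
          ← measure_iUnion hd hm, ← hBT]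
  refine key.trans (add_le_add_right ?_ _)
  rw [← ENNReal.coe_toNNReal hBf.ne, ← ENNReal.coe_mul, ENNReal.coe_le_coe, ENNReal.toNNReal_coe,
    div_mul_eq_mul_div]
  exact div_le_of_le_mul₀ (by positivity) (by positivity) (by gcongr; exact le_self_add)

/-- The area formula, as an identity of measures: the image under `Ξ` of `J μ` on `A` has as
density the multiplicity function of `Ξ` on `A`. -/
theorem exists_multiplicity (h : HasLocalJacobian μ ν X Ξ J) (hΞ : Continuous Ξ) {A : Set α}
    (hAX : A ⊆ X) (hA : NullMeasurableSet A μ) :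
    ∃ mult : β → ℝ≥0∞, Measurable mult ∧
      (∀ᵐ y ∂ν, mult y = ∑' _ : {q // q ∈ A ∧ Ξ q = y}, 1) ∧
      ((μ.restrict A).withDensity fun q => (J q : ℝ≥0∞)).map Ξ = ν.withDensity mult := by
  obtain ⟨A₀, hA₀A, hA₀m, hA₀⟩ := hA.exists_measurable_subset_ae_eq
  have hA₀X := hA₀A.trans hAX
  obtain ⟨u, hu, hXu⟩ := continuousOn_iff'.1 h.continuousOn (Ioi 0) isOpen_Ioi
  have hmem : ∀ x ∈ X, (x ∈ u ↔ 0 < J x) := fun x hx =>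
    ⟨fun hxu => ((hXu.symm.subset ⟨hxu, hx⟩).1 : _), fun hJ => (hXu.subset ⟨hJ, hx⟩).1⟩
  obtain ⟨T, hTm, hTd, hXT, hT⟩ := exists_measurable_partition (X := X ∩ u)
    (P := fun S => μ S < ∞ ∧ InjOn Ξ S) (by simp)
    (fun S T hST hT => ⟨(measure_mono hST).trans_lt hT.1, hT.2.mono hST⟩)
    (fun q hq => by
      obtain ⟨O, hO, hO'⟩ := h.finite q hq.1
      obtain ⟨O₁, hO₁, hO₁', -⟩ := h.le_measure_image q hq.1 0 ((hmem q hq.1).1 hq.2)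
      refine ⟨O ∩ O₁, inter_mem hO hO₁, (measure_mono ?_).trans_lt hO', hO₁'.mono ?_⟩
      · exact fun x hx => ⟨hx.1.1, hx.2.1⟩
      · exact fun x hx => ⟨hx.1.2, hx.2.1⟩)
  set B : ℕ → Set α := fun i => A₀ ∩ u ∩ T i with hBdef
  have hBX : ∀ i, B i ⊆ X := fun i x hx => hA₀X hx.1.1
  have hBT : ∀ i, B i ⊆ T i ∩ (X ∩ u) := fun i x hx => ⟨hx.2, hA₀X hx.1.1, hx.1.2⟩
  have hBm : ∀ i, MeasurableSet (B i) := fun i => (hA₀m.inter hu.measurableSet).inter (hTm i)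
  have hBinj : ∀ i, InjOn Ξ (B i) := fun i => (hT i).2.mono (hBT i)
  have hBf : ∀ i, μ (B i) < ∞ := fun i => (measure_mono (hBT i)).trans_lt (hT i).1
  have hBd : Pairwise (Function.onFun Disjoint B) := fun i j hij =>
    (hTd hij).mono inter_subset_right inter_subset_right
  have hBU : ⋃ i, B i = A₀ ∩ u := by
    rw [← inter_iUnion, inter_eq_left]
    exact fun x hx => hXT ⟨hA₀X hx.1, hx.2⟩
  have hBim : ∀ i, MeasurableSet (Ξ '' B i) := fun i =>
    (hBm i).image_of_continuousOn_injOn hΞ.continuousOn (hBinj i)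
  refine ⟨fun y => ∑' i, (Ξ '' B i).indicator 1 y, ?_, ?_, ?_⟩
  · exact Measurable.tsum fun i => measurable_one.indicator (hBim i)
  · have hnull : ν (Ξ '' (A \ A₀) ∪ Ξ '' (A₀ \ u)) = 0 := by
      refine measure_union_null ?_ ?_
      · exact h.measure_image_eq_zero_of_null (sdiff_subset.trans hAX) (ae_le_set.1 hA₀.symm.le)
      · refine h.measure_image_eq_zero_of_jacobian_eq_zero (sdiff_subset.trans hA₀X)
          (hA₀m.diff hu.measurableSet) fun x hx => ?_
        have := mt (hmem x (hA₀X hx.1)).2 hx.2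
        simpa using this
    filter_upwards [compl_mem_ae_iff.2 hnull] with y hy
    have hfib : ∀ q, q ∈ A ∧ Ξ q = y ↔ q ∈ A₀ ∩ u ∧ Ξ q = y := by
      refine fun q => ⟨fun hq => ⟨?_, hq.2⟩, fun hq => ⟨hA₀A hq.1.1, hq.2⟩⟩
      by_contra hcon
      refine hy ?_
      by_cases hqA : q ∈ A₀
      · exact Or.inr ⟨q, ⟨hqA, fun hqu => hcon ⟨hqA, hqu⟩⟩, hq.2⟩
      · exact Or.inl ⟨q, ⟨hq.1, hqA⟩, hq.2⟩
    have hind : ∀ i, (Ξ '' B i).indicator (1 : β → ℝ≥0∞) y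
        = ∑' q : α, (B i ∩ Ξ ⁻¹' {y}).indicator 1 q := by
      intro i
      by_cases hyi : y ∈ Ξ '' B i
      · obtain ⟨q, hq, rfl⟩ := hyi
        rw [indicator_of_mem (mem_image_of_mem _ hq), tsum_eq_single q]
        · simp [hq]
        · intro q' hq'
          exact indicator_of_notMem (fun hmem => hq' (hBinj i hmem.1 hq hmem.2)) _
      · rw [indicator_of_notMem hyi, eq_comm, ENNReal.tsum_eq_zero]
        exact fun q => indicator_of_notMem (fun hmem => hyi ⟨q, hmem.1, hmem.2⟩) _
    simp_rw [hind]
    rw [ENNReal.tsum_comm]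
    have : ∀ q, ∑' i, (B i ∩ Ξ ⁻¹' {y}).indicator (1 : α → ℝ≥0∞) q
        = {q | q ∈ A ∧ Ξ q = y}.indicator (fun _ => 1) q := by
      intro q
      by_cases hq : q ∈ A ∧ Ξ q = y
      · have hqU : q ∈ ⋃ i, B i := by rw [hBU]; exact ((hfib q).1 hq).1
        obtain ⟨i, hi⟩ := mem_iUnion.1 hqU
        rw [indicator_of_mem (by exact hq), tsum_eq_single i]
        · simp [hi, hq.2]
        · intro j hj
          exact indicator_of_notMem (fun hmem => (hBd hj).ne_of_mem hmem.1 hi rfl) _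
      · rw [indicator_of_notMem (by exact hq), ENNReal.tsum_eq_zero]
        refine fun i => indicator_of_notMem (fun hmem => hq ((hfib q).2 ⟨hmem.1.1, hmem.2⟩)) _
    simp_rw [this]
    exact (tsum_subtype {q | q ∈ A ∧ Ξ q = y} (fun _ => (1 : ℝ≥0∞))).symm
  · ext s hs
    rw [Measure.map_apply hΞ.measurable hs, withDensity_apply _ (hΞ.measurable hs),
      Measure.restrict_restrict (hΞ.measurable hs), withDensity_apply _ hs,
      lintegral_tsum fun i => (measurable_one.indicator (hBim i)).aemeasurable]
    have hsm := hΞ.measurable hs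
    have h1 : ∀ i, ∫⁻ y in s, (Ξ '' B i).indicator 1 y ∂ν = ∫⁻ q in Ξ ⁻¹' s ∩ B i, J q ∂μ := by
      intro i
      rw [lintegral_indicator_one (hBim i), Measure.restrict_apply (hBim i),
        ← image_inter_preimage, inter_comm]
      have hsub : Ξ ⁻¹' s ∩ B i ⊆ B i := inter_subset_right
      have hf := (measure_mono hsub).trans_lt (hBf i)
      exact le_antisymm
        (h.measure_image_le_lintegral (hsub.trans (hBX i)) (hsm.inter (hBm i)) hf)
        (h.lintegral_le_measure_image hΞ (hsub.trans (hBX i)) (hsm.inter (hBm i)) hf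
          ((hBinj i).mono hsub))
    simp_rw [h1]
    rw [← lintegral_iUnion (fun i => hsm.inter (hBm i)), ← inter_iUnion, hBU]
    · have h2 : ∫⁻ q in Ξ ⁻¹' s ∩ A, J q ∂μ = ∫⁻ q in Ξ ⁻¹' s ∩ A₀, J q ∂μ :=
        setLIntegral_congr ((ae_eq_refl _).inter hA₀.symm)
      rw [h2, ← lintegral_inter_add_sdiff _ (Ξ ⁻¹' s ∩ A₀) hu.measurableSet, inter_assoc]
      convert! add_zero _
      rw [setLIntegral_congr_fun ((hsm.inter hA₀m).diff hu.measurableSet) (g := fun _ => 0)]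
      · simp
      · intro x hx
        have := mt (hmem x (hA₀X hx.1.2)).2 hx.2
        simpa using this
    · exact fun i j hij => (hBd hij).mono inter_subset_right inter_subset_right

/-- A criterion for finite multiplicity: the integrals of the Jacobian over the preimages of
countably many sets which cover the target are finite. -/
theorem ae_finite_fiber (h : HasLocalJacobian μ ν X Ξ J) (hΞ : Continuous Ξ) {A : Set α}
    (hAX : A ⊆ X) (hA : NullMeasurableSet A μ) {Y : ℕ → Set β} (hYm : ∀ j, MeasurableSet (Y j))
    (hY : ⋃ j, Y j = univ) (hfin : ∀ j, ∫⁻ q in Ξ ⁻¹' Y j ∩ A, J q ∂μ < ∞) :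
    ∀ᵐ y ∂ν, {q ∈ A | Ξ q = y}.Finite := by
  obtain ⟨mult, hm, hae, heq⟩ := h.exists_multiplicity hΞ hAX hA
  have hlt : ∀ᵐ y ∂ν, mult y < ∞ := by
    rw [← Measure.restrict_univ (μ := ν), ← hY, ae_restrict_iUnion_iff]
    intro j
    refine ae_lt_top hm (ne_of_lt ?_)
    rw [← withDensity_apply _ (hYm j), ← heq, Measure.map_apply hΞ.measurable (hYm j),
      withDensity_apply _ (hΞ.measurable (hYm j)),
      Measure.restrict_restrict (hΞ.measurable (hYm j))]
    exact hfin j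
  filter_upwards [hae, hlt] with y hy hy'
  rw [hy] at hy'
  have h2 : ∑' _ : {q // q ∈ A ∧ Ξ q = y}, (1 : ℝ≥0∞) = ({q ∈ A | Ξ q = y}.encard : ℝ≥0∞) :=
    ENNReal.tsum_set_one {q | q ∈ A ∧ Ξ q = y}
  rw [h2] at hy'
  exact encard_lt_top_iff.1 (by simpa using hy')

/-- The area formula for integrals. Neither `Ξ '' A` nor the fibres need be measurable in the strict
sense: the multiplicity function of `exists_multiplicity` replaces them almost everywhere. -/
theorem integral_tsum_fiber (h : HasLocalJacobian μ ν X Ξ J) (hΞ : Continuous Ξ) {A : Set α}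
    (hAX : A ⊆ X) (hA : NullMeasurableSet A μ) {f : β → ℝ}
    (hf : AEStronglyMeasurable f (ν.restrict (Ξ '' A)))
    (hfin : ∀ᵐ y ∂ν, {q ∈ A | Ξ q = y}.Finite) :
    (IntegrableOn (fun y => ∑' _ : {q // q ∈ A ∧ Ξ q = y}, f y) (Ξ '' A) ν ↔
      IntegrableOn (fun q => f (Ξ q) * J q) A μ) ∧
    ∫ y in Ξ '' A, (∑' _ : {q // q ∈ A ∧ Ξ q = y}, f y) ∂ν = ∫ q in A, f (Ξ q) * J q ∂μ := by
  obtain ⟨mult, hm, hae, heq⟩ := h.exists_multiplicity hΞ hAX hA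
  have hJ : AEMeasurable J (μ.restrict A) := by
    obtain ⟨A₀, hA₀A, hA₀m, hA₀⟩ := hA.exists_measurable_subset_ae_eq
    rw [← Measure.restrict_congr_set hA₀]
    exact (h.continuousOn.mono (hA₀A.trans hAX)).aemeasurable hA₀m
  -- The set where the multiplicity is not zero is a measurable substitute for `Ξ '' A`.
  have hS : (Ξ '' A : Set β) =ᵐ[ν] {y | mult y ≠ 0} := by
    rw [eventuallyEq_set]
    filter_upwards [hae] with y hy
    rw [hy, Ne, ENNReal.tsum_eq_zero]
    simp [mem_image]
  have hSm : MeasurableSet {y | mult y ≠ 0} := (measurableSet_eq_fun hm measurable_const).compl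
  have hν : ν.withDensity mult = (ν.restrict (Ξ '' A)).withDensity mult := by
    rw [Measure.restrict_congr_set hS, ← withDensity_indicator hSm]
    congr 1
    exact (indicator_eq_self.2 fun y hy => hy).symm
  have hcard : ∀ᵐ y ∂ν, mult y < ∞ ∧
      ∑' _ : {q // q ∈ A ∧ Ξ q = y}, f y = (mult y).toReal • f y := by
    filter_upwards [hae, hfin] with y hy hy'
    have h2 : ∑' _ : {q // q ∈ A ∧ Ξ q = y}, (1 : ℝ≥0∞) = ({q ∈ A | Ξ q = y}.encard : ℝ≥0∞) :=
      ENNReal.tsum_set_one {q | q ∈ A ∧ Ξ q = y}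
    rw [h2] at hy
    constructor
    · rw [hy]
      simpa using hy'
    · have hc : Nat.card {q // q ∈ A ∧ Ξ q = y} = {q ∈ A | Ξ q = y}.ncard :=
        Nat.card_coe_set_eq {q | q ∈ A ∧ Ξ q = y}
      rw [tsum_const, hy, hc, ← hy'.cast_ncard_eq, nsmul_eq_mul, smul_eq_mul]
      simp
  have hlt := ae_restrict_of_ae (s := Ξ '' A) (hcard.mono fun _ hy => hy.1)
  have hcongr := ae_restrict_of_ae (s := Ξ '' A) (hcard.mono fun _ hy => hy.2)
  have hfm : AEStronglyMeasurable f
      (((μ.restrict A).withDensity fun q => (J q : ℝ≥0∞)).map Ξ) := by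
    rw [heq, hν]
    exact hf.mono_ac (withDensity_absolutelyContinuous _ _)
  constructor
  · rw [IntegrableOn, integrable_congr hcongr,
      ← integrable_withDensity_iff_integrable_smul' hm hlt, ← hν, ← heq,
      integrable_map_measure hfm hΞ.aemeasurable, integrable_withDensity_iff_integrable_smul₀ hJ]
    simp only [IntegrableOn, NNReal.smul_def, smul_eq_mul, mul_comm, Function.comp]
  · rw [integral_congr_ae hcongr, ← integral_withDensity_eq_integral_toReal_smul hm hlt, ← hν,
      ← heq, integral_map hΞ.aemeasurable hfm, integral_withDensity_eq_integral_smul₀ hJ]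
    simp only [NNReal.smul_def, smul_eq_mul, mul_comm]

end

end HasLocalJacobian

/-! ### Hausdorff measure in charts with isometric derivative -/

/-- `φ` parametrizes the part of `X` near `q`, with an isometric derivative at `0`. Only a
one-sided inverse `κ` on `X` is required: the values of `φ` need not lie in `X`. -/
structure IsIsometricChart {V E : Type*} [NormedAddCommGroup V] [NormedSpace ℝ V]
    [NormedAddCommGroup E] [NormedSpace ℝ E] (X : Set E) (q : E) (φ : V → E)
    (φ' : V →L[ℝ] E) (κ : E → V) : Prop where
  hasStrictFDerivAt : HasStrictFDerivAt φ φ' 0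
  norm_map : ∀ v, ‖φ' v‖ = ‖v‖
  tendsto : Tendsto κ (𝓝[X] q) (𝓝 0)
  right_inv : ∀ᶠ x in 𝓝[X] q, φ (κ x) = x

theorem IsIsometricChart.exists_nhds_image_eq {V E : Type*} [NormedAddCommGroup V]
    [NormedSpace ℝ V] [NormedAddCommGroup E] [NormedSpace ℝ E] {X : Set E} {q : E} {φ : V → E}
    {φ' : V →L[ℝ] E} {κ : E → V} (h : IsIsometricChart X q φ φ' κ) {O : Set V} (hO : O ∈ 𝓝 0) :
    ∃ U ∈ 𝓝 q, ∀ B ⊆ U ∩ X, κ '' B ⊆ O ∧ φ '' (κ '' B) = B := by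
  obtain ⟨U, hU, hUX⟩ := mem_nhdsWithin_iff_exists_mem_nhds_inter.1
    ((h.tendsto.eventually hO).and h.right_inv)
  refine ⟨U, hU, fun B hB => ⟨?_, ?_⟩⟩
  · rintro _ ⟨x, hx, rfl⟩
    exact (hUX (hB hx)).1
  · rw [image_image]
    exact (image_congr fun x hx => (hUX (hB hx)).2).trans (image_id' B)

section Charts

variable {V E E₁ E₂ : Type*} [NormedAddCommGroup V] [InnerProductSpace ℝ V]
  [MeasurableSpace V] [BorelSpace V]
  [NormedAddCommGroup E] [NormedSpace ℝ E] [MeasurableSpace E] [BorelSpace E]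
  [NormedAddCommGroup E₁] [NormedSpace ℝ E₁] [MeasurableSpace E₁] [BorelSpace E₁]
  [NormedAddCommGroup E₂] [NormedSpace ℝ E₂] [MeasurableSpace E₂] [BorelSpace E₂]

theorem _root_.LipschitzOnWith.euclideanHausdorffMeasure_image_le {X Y : Type*} [EMetricSpace X]
    [MeasurableSpace X] [BorelSpace X] [EMetricSpace Y] [MeasurableSpace Y] [BorelSpace Y]
    {K : ℝ≥0} {f : X → Y} {s : Set X} (h : LipschitzOnWith K f s) (d : ℕ) :
    μHE[d] (f '' s) ≤ (K : ℝ≥0∞) ^ d * μHE[d] s := by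
  have := h.hausdorffMeasure_image_le (d := d) (by positivity)
  rw [ENNReal.rpow_natCast] at this
  rw [Measure.euclideanHausdorffMeasure_def, Measure.euclideanHausdorffMeasure_def,
    Measure.smul_apply, Measure.smul_apply, ENNReal.smul_def, ENNReal.smul_def, smul_eq_mul,
    smul_eq_mul, mul_left_comm]
  gcongr

/-- A map whose strict derivative at `x` is isometric is nearly isometric near `x`. -/
theorem exists_nhds_euclideanHausdorffMeasure_comparable {φ : V → E} {φ' : V →L[ℝ] E} {x : V}
    (hφ : HasStrictFDerivAt φ φ' x) (hiso : ∀ v, ‖φ' v‖ = ‖v‖) (d : ℕ) {c : ℝ≥0} (hc : 1 < c) :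
    ∃ O ∈ 𝓝 x, InjOn φ O ∧ ∀ B ⊆ O, μHE[d] (φ '' B) ≤ c * μHE[d] B ∧
      μHE[d] B ≤ c * μHE[d] (φ '' B) := by
  obtain ⟨δ, hδ0, hδ1, hδc, hδc'⟩ : ∃ δ : ℝ≥0, 0 < δ ∧ δ < 1 ∧ (1 + δ) ^ d ≤ c ∧
      ((1 - δ)⁻¹) ^ d ≤ c := by
    have h1 : Tendsto (fun δ : ℝ≥0 => (1 + δ) ^ d) (𝓝 0) (𝓝 1) := by
      have : Continuous fun δ : ℝ≥0 => (1 + δ) ^ d := by fun_prop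
      simpa using this.tendsto 0
    have h2 : Tendsto (fun δ : ℝ≥0 => ((1 - δ)⁻¹) ^ d) (𝓝 0) (𝓝 1) := by
      have : ContinuousAt (fun δ : ℝ≥0 => ((1 - δ)⁻¹) ^ d) 0 := by
        refine ContinuousAt.pow (ContinuousAt.inv₀ ?_ (by simp)) d
        exact (continuous_const.sub continuous_id).continuousAt
      simpa using this.tendsto
    have h3 := ((h1.eventually_le_const hc).and ((h2.eventually_le_const hc).and
      (eventually_lt_nhds (zero_lt_one : (0 : ℝ≥0) < 1))))
    obtain ⟨δ, ⟨h, h', h''⟩, hpos⟩ := ((h3.filter_mono nhdsWithin_le_nhds).and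
      (self_mem_nhdsWithin : Ioi (0 : ℝ≥0) ∈ 𝓝[>] 0)).exists
    exact ⟨δ, hpos, h'', h, h'⟩
  obtain ⟨O, hO, happ⟩ := hφ.approximates_deriv_on_nhds (c := δ) (Or.inr hδ0)
  have hup : ∀ y ∈ O, ∀ z ∈ O, ‖φ y - φ z‖ ≤ (1 + δ) * ‖y - z‖ := by
    intro y hy z hz
    have h1 := happ y hy z hz
    have h2 := norm_le_norm_add_norm_sub (φ' (y - z)) (φ y - φ z)
    rw [hiso, norm_sub_rev (φ' (y - z))] at h2
    linarith
  have hlow : ∀ y ∈ O, ∀ z ∈ O, (1 - δ) * ‖y - z‖ ≤ ‖φ y - φ z‖ := by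
    intro y hy z hz
    have h1 := happ y hy z hz
    have h2 := norm_le_norm_add_norm_sub' (φ' (y - z)) (φ y - φ z)
    rw [hiso, norm_sub_rev (φ' (y - z))] at h2
    linarith
  have hδ1' : (0 : ℝ) < 1 - δ := by
    have : (δ : ℝ) < 1 := by exact_mod_cast hδ1
    linarith
  have hinj : InjOn φ O := by
    intro y hy z hz hyz
    have := hlow y hy z hz
    rw [hyz, sub_self, norm_zero] at this
    exact sub_eq_zero.1 (norm_eq_zero.1 (le_antisymm (nonpos_of_mul_nonpos_right this hδ1')
      (norm_nonneg _)))
  refine ⟨O, hO, hinj, fun B hB => ⟨?_, ?_⟩⟩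
  · have hlip : LipschitzOnWith (1 + δ) φ B := LipschitzOnWith.of_dist_le_mul fun y hy z hz => by
      rw [dist_eq_norm, dist_eq_norm]
      exact_mod_cast hup y (hB hy) z (hB hz)
    refine (hlip.euclideanHausdorffMeasure_image_le d).trans ?_
    gcongr
    exact_mod_cast hδc
  · rcases B.eq_empty_or_nonempty with rfl | ⟨b, -⟩
    · simp
    have : Nonempty V := ⟨b⟩
    have hli : ∀ y ∈ B, Function.invFunOn φ B (φ y) = y := fun y hy =>
      (hinj.mono hB).leftInvOn_invFunOn hy
    have hlip : LipschitzOnWith ((1 - δ)⁻¹) (Function.invFunOn φ B) (φ '' B) := by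
      refine LipschitzOnWith.of_dist_le_mul ?_
      rintro _ ⟨y, hy, rfl⟩ _ ⟨z, hz, rfl⟩
      rw [hli y hy, hli z hz, dist_eq_norm, dist_eq_norm, NNReal.coe_inv,
        NNReal.coe_sub hδ1.le, NNReal.coe_one, le_inv_mul_iff₀ hδ1']
      exact hlow y (hB hy) z (hB hz)
    have := hlip.euclideanHausdorffMeasure_image_le d
    rw [(hinj.mono hB).invFunOn_image Subset.rfl] at this
    refine this.trans ?_
    gcongr
    exact_mod_cast hδc'

variable [FiniteDimensional ℝ V]

namespace IsIsometricChart

variable {X : Set E₁} {q : E₁} {φ : V → E₁} {φ' : V →L[ℝ] E₁} {κ : E₁ → V}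

theorem exists_nhds_measure_lt_top (h : IsIsometricChart X q φ φ' κ) :
    ∃ U ∈ 𝓝 q, μHE[Module.finrank ℝ V] (U ∩ X) < ∞ := by
  obtain ⟨O, hO, -, hcomp⟩ := exists_nhds_euclideanHausdorffMeasure_comparable
    h.hasStrictFDerivAt h.norm_map (Module.finrank ℝ V) one_lt_two
  obtain ⟨U, hU, hUX⟩ := h.exists_nhds_image_eq (inter_mem hO (Metric.ball_mem_nhds 0 one_pos))
  obtain ⟨hsub, heq⟩ := hUX _ Subset.rfl
  refine ⟨U, hU, ?_⟩
  rw [← heq]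
  refine (hcomp _ (hsub.trans inter_subset_left)).1.trans_lt (ENNReal.mul_lt_top (by simp) ?_)
  exact (measure_mono (hsub.trans inter_subset_right)).trans_lt measure_ball_lt_top

variable {ψ : V → E₂} {ψ' : V →L[ℝ] E₂} {g : V → V} {g' : V →L[ℝ] V} {Ξ : E₁ → E₂}

/-- The charts `φ` and `ψ` distort the Hausdorff measure by a factor near `1`, and `g`, the map `Ξ`
read in these charts, multiplies Lebesgue measure by at most a factor near `|det g'|`. -/
theorem exists_nhds_measure_image_le (h : IsIsometricChart X q φ φ' κ)
    (hψ : HasStrictFDerivAt ψ ψ' 0) (hψ' : ∀ v, ‖ψ' v‖ = ‖v‖) (hg : HasStrictFDerivAt g g' 0)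
    (hg0 : g 0 = 0) (hΞ : ∀ᶠ x in 𝓝 0, Ξ (φ x) = ψ (g x)) {m : ℝ≥0} (hm : |g'.det| < m) :
    ∃ U ∈ 𝓝 q, ∀ B ⊆ U ∩ X,
      μHE[Module.finrank ℝ V] (Ξ '' B) ≤ m * μHE[Module.finrank ℝ V] B := by
  set d := Module.finrank ℝ V
  obtain ⟨c, hc1, m', hm', hcm⟩ : ∃ c : ℝ≥0, 1 < c ∧ ∃ m' : ℝ≥0,
      |g'.det| < m' ∧ c * m' * c ≤ m := by
    obtain ⟨m', h1, h2⟩ := exists_between hm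
    have hm'0 : 0 ≤ m' := (abs_nonneg _).trans h1.le
    lift m' to ℝ≥0 using hm'0
    have hlim : Tendsto (fun c : ℝ≥0 => c * m' * c) (𝓝 1) (𝓝 m') := by
      have : Continuous fun c : ℝ≥0 => c * m' * c := by fun_prop
      simpa using this.tendsto 1
    have := hlim.eventually_le_const (show m' < m by exact_mod_cast h2)
    obtain ⟨c, hc, hc'⟩ := ((this.filter_mono nhdsWithin_le_nhds).and
      (self_mem_nhdsWithin : Ioi (1 : ℝ≥0) ∈ 𝓝[>] 1)).exists
    exact ⟨c, hc', m', h1, hc⟩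
  have hdet : ENNReal.ofReal |g'.det| < m' := by
    rw [ENNReal.ofReal_lt_coe_iff (abs_nonneg _)]
    exact hm'
  obtain ⟨O₁, hO₁, -, h₁⟩ := exists_nhds_euclideanHausdorffMeasure_comparable
    h.hasStrictFDerivAt h.norm_map d hc1
  obtain ⟨O₂, hO₂, -, h₂⟩ := exists_nhds_euclideanHausdorffMeasure_comparable hψ hψ' d hc1
  obtain ⟨δ, hδ, hδ0⟩ := ((addHaar_image_le_mul_of_det_lt (volume : Measure V) g' hdet).and
    self_mem_nhdsWithin).exists
  obtain ⟨O₃, hO₃, happ⟩ := hg.approximates_deriv_on_nhds (c := δ) (Or.inr hδ0)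
  have hgO : g ⁻¹' O₂ ∈ 𝓝 0 := hg.continuousAt.preimage_mem_nhds (by rwa [hg0])
  obtain ⟨U, hU, hUX⟩ := h.exists_nhds_image_eq
    (inter_mem (inter_mem hO₁ hO₃) (inter_mem hgO hΞ))
  refine ⟨U, hU, fun B hB => ?_⟩
  obtain ⟨hsub, heq⟩ := hUX B hB
  have himage : Ξ '' B = ψ '' (g '' (κ '' B)) := by
    conv_lhs => rw [← heq]
    rw [image_image Ξ φ, image_image ψ g]
    exact image_congr fun x hx => (hsub hx).2.2
  have hvol : (μHE[d] : Measure V) = volume := InnerProductSpace.euclideanHausdorffMeasure_eq_volume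
  calc μHE[d] (Ξ '' B) ≤ c * μHE[d] (g '' (κ '' B)) := by
        rw [himage]
        exact (h₂ _ (image_subset_iff.2 fun x hx => (hsub hx).2.1)).1
    _ ≤ c * (m' * μHE[d] (κ '' B)) := by
        rw [hvol]
        gcongr
        exact hδ _ g (happ.mono_set fun x hx => (hsub hx).1.2)
    _ ≤ c * (m' * (c * μHE[d] (φ '' (κ '' B)))) := by
        gcongr
        exact (h₁ _ fun x hx => (hsub hx).1.1).2
    _ = ((c * m' * c : ℝ≥0) : ℝ≥0∞) * μHE[d] B := by
        rw [heq]
        push_cast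
        ring
    _ ≤ m * μHE[d] B := by gcongr

theorem exists_nhds_le_measure_image (h : IsIsometricChart X q φ φ' κ)
    (hψ : HasStrictFDerivAt ψ ψ' 0) (hψ' : ∀ v, ‖ψ' v‖ = ‖v‖) (hg : HasStrictFDerivAt g g' 0)
    (hg0 : g 0 = 0) (hΞ : ∀ᶠ x in 𝓝 0, Ξ (φ x) = ψ (g x)) {m : ℝ≥0} (hm : m < |g'.det|) :
    ∃ U ∈ 𝓝 q, InjOn Ξ (U ∩ X) ∧ ∀ B ⊆ U ∩ X,
      m * μHE[Module.finrank ℝ V] B ≤ μHE[Module.finrank ℝ V] (Ξ '' B) := by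
  set d := Module.finrank ℝ V
  obtain ⟨c, hc1, m', hm', hcm⟩ : ∃ c : ℝ≥0, 1 < c ∧ ∃ m' : ℝ≥0,
      m' < |g'.det| ∧ m * c * c ≤ m' := by
    obtain ⟨m', h1, h2⟩ := exists_between hm
    lift m' to ℝ≥0 using m.2.trans h1.le
    have hlim : Tendsto (fun c : ℝ≥0 => m * c * c) (𝓝 1) (𝓝 m) := by
      have : Continuous fun c : ℝ≥0 => m * c * c := by fun_prop
      simpa using this.tendsto 1
    have := hlim.eventually_le_const (show m < m' by exact_mod_cast h1)
    obtain ⟨c, hc, hc'⟩ := ((this.filter_mono nhdsWithin_le_nhds).and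
      (self_mem_nhdsWithin : Ioi (1 : ℝ≥0) ∈ 𝓝[>] 1)).exists
    exact ⟨c, hc', m', h2, hc⟩
  have hdet : (m' : ℝ≥0∞) < ENNReal.ofReal |g'.det| := by
    rw [ENNReal.coe_lt_ofReal]
    exact hm'
  have hdet0 : g'.det ≠ 0 := abs_pos.1 (m.2.trans_lt hm)
  obtain ⟨O₁, hO₁, -, h₁⟩ := exists_nhds_euclideanHausdorffMeasure_comparable
    h.hasStrictFDerivAt h.norm_map d hc1
  obtain ⟨O₂, hO₂, hinj₂, h₂⟩ := exists_nhds_euclideanHausdorffMeasure_comparable hψ hψ' d hc1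
  obtain ⟨δ, hδ, hδ0⟩ := ((mul_le_addHaar_image_of_lt_det (volume : Measure V) g' hdet).and
    self_mem_nhdsWithin).exists
  obtain ⟨O₃, hO₃, happ⟩ := hg.approximates_deriv_on_nhds (c := δ) (Or.inr hδ0)
  obtain ⟨O₄, hO₄, hinj₄⟩ : ∃ O ∈ 𝓝 (0 : V), InjOn g O := by
    have hg₂ : HasStrictFDerivAt g
        (g'.toContinuousLinearEquivOfDetNeZero hdet0 : V →L[ℝ] V) 0 := by
      simpa using hg
    exact ⟨_, (hg₂.toOpenPartialHomeomorph g).open_source.mem_nhds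
      hg₂.mem_toOpenPartialHomeomorph_source, (hg₂.toOpenPartialHomeomorph g).injOn⟩
  have hgO : g ⁻¹' O₂ ∈ 𝓝 0 := hg.continuousAt.preimage_mem_nhds (by rwa [hg0])
  obtain ⟨U, hU, hUX⟩ := h.exists_nhds_image_eq
    (inter_mem (inter_mem hO₁ (inter_mem hO₃ hO₄)) (inter_mem hgO hΞ))
  refine ⟨U, hU, fun x hx y hy hxy => ?_, fun B hB => ?_⟩
  · obtain ⟨hsub, heq⟩ := hUX _ Subset.rfl
    rw [← heq] at hx hy
    obtain ⟨s, hs, rfl⟩ := hx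
    obtain ⟨t, ht, rfl⟩ := hy
    rw [(hsub hs).2.2, (hsub ht).2.2] at hxy
    rw [hinj₄ (hsub hs).1.2.2 (hsub ht).1.2.2 (hinj₂ (hsub hs).2.1 (hsub ht).2.1 hxy)]
  obtain ⟨hsub, heq⟩ := hUX B hB
  have himage : Ξ '' B = ψ '' (g '' (κ '' B)) := by
    conv_lhs => rw [← heq]
    rw [image_image Ξ φ, image_image ψ g]
    exact image_congr fun x hx => (hsub hx).2.2
  have hvol : (μHE[d] : Measure V) = volume := InnerProductSpace.euclideanHausdorffMeasure_eq_volume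
  have hc0 : (c : ℝ≥0∞) ≠ 0 := by
    simpa using (zero_lt_one.trans hc1).ne'
  refine (ENNReal.mul_le_mul_iff_right hc0 ENNReal.coe_ne_top).1 ?_
  calc (c : ℝ≥0∞) * (m * μHE[d] B) = c * (m * μHE[d] (φ '' (κ '' B))) := by rw [heq]
    _ ≤ c * (m * (c * μHE[d] (κ '' B))) := by
        gcongr
        exact (h₁ _ fun x hx => (hsub hx).1.1).1
    _ = ((m * c * c : ℝ≥0) : ℝ≥0∞) * μHE[d] (κ '' B) := by
        push_cast
        ring
    _ ≤ m' * μHE[d] (κ '' B) := by gcongr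
    _ ≤ μHE[d] (g '' (κ '' B)) := by
        rw [hvol]
        exact hδ _ g (happ.mono_set fun x hx => (hsub hx).1.2.1)
    _ ≤ c * μHE[d] (Ξ '' B) := by
        rw [himage]
        exact (h₂ _ (image_subset_iff.2 fun x hx => (hsub hx).2.1)).2

end IsIsometricChart

end Charts

/-! ### Simple `k`-vectors -/

section Wedge

variable {n k : ℕ}

theorem continuous_wedge : Continuous (wedge : (Fin k → Vec n) → KVec n k) := by
  rw [continuous_iff_continuousAt]
  intro v
  have hexp : ∀ w : Fin k → Vec n, ‖wedge w - wedge v‖ ^ 2 =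
      (Matrix.of fun i j => inner ℝ (w i) (w j)).det
        - 2 * (Matrix.of fun i j => inner ℝ (w i) (v j)).det
        + (Matrix.of fun i j => inner ℝ (v i) (v j)).det := by
    intro w
    rw [norm_sub_sq_real, ← real_inner_self_eq_norm_sq, ← real_inner_self_eq_norm_sq,
      inner_wedge_wedge, inner_wedge_wedge, inner_wedge_wedge]
  have hcont : Continuous fun w : Fin k → Vec n => ‖wedge w - wedge v‖ ^ 2 := by
    simp_rw [hexp]
    refine ((Continuous.matrix_det ?_).sub (continuous_const.mul (Continuous.matrix_det ?_))).add
      continuous_const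
    · refine continuous_matrix fun i j => ?_
      simp only [Matrix.of_apply]
      fun_prop
    · refine continuous_matrix fun i j => ?_
      simp only [Matrix.of_apply]
      fun_prop
  rw [ContinuousAt, tendsto_iff_norm_sub_tendsto_zero]
  have := (hcont.tendsto v).sqrt
  simpa using this

/-- The wedge product as a continuous multilinear map. -/
noncomputable def wedgeMultilinear (n k : ℕ) :
    ContinuousMultilinearMap ℝ (fun _ : Fin k => Vec n) (KVec n k) where
  toMultilinearMap := (exteriorPower.ιMulti ℝ k (M := Vec n)).toMultilinearMap
  cont := continuous_wedge

theorem wedgeMultilinear_apply (v : Fin k → Vec n) : wedgeMultilinear n k v = wedge v := rfl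

theorem inner_smul_left_kvec (r : ℝ) (x y : KVec n k) : inner ℝ (r • x) y = r * inner ℝ x y :=
  real_inner_smul_left x y r

theorem inner_smul_right_kvec (r : ℝ) (x y : KVec n k) : inner ℝ x (r • y) = r * inner ℝ x y :=
  real_inner_smul_right x y r

theorem wedge_sum_smul (G : Matrix (Fin k) (Fin k) ℝ) (v : Fin k → Vec n) :
    wedge (fun i => ∑ j, G i j • v j) = G.det • wedge v := by
  refine ext_inner_left ℝ fun x => ?_
  rw [inner_smul_right_kvec]
  let L : KVec n k →ₗ[ℝ] ℝ := (innerSL ℝ x).toLinearMap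
  let g : (Fin k → ℝ) [⋀^Fin k]→ₗ[ℝ] ℝ :=
    (L.compAlternatingMap (exteriorPower.ιMulti ℝ k (M := Vec n))).compLinearMap
      (Fintype.linearCombination ℝ v)
  have hg : ∀ w : Fin k → Fin k → ℝ, g w = inner ℝ x (wedge fun i => ∑ j, w i j • v j) :=
    fun w => rfl
  have h1 : ∀ w : Fin k → Fin k → ℝ, g w = g (Pi.basisFun ℝ (Fin k)) * (Matrix.of w).det := by
    intro w
    rw [← Pi.basisFun_det_apply]
    exact congrArg (fun f => f w) (g.eq_smul_basis_det (Pi.basisFun ℝ (Fin k)))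
  have h2 : g (Pi.basisFun ℝ (Fin k)) = inner ℝ x (wedge v) := by
    rw [hg]
    congr 2
    ext1 i
    simp [Pi.single_apply]
  rw [mul_comm, ← h2]
  exact (hg G).symm.trans (h1 G)

theorem norm_wedge_of_orthonormal {e : Fin k → Vec n} (he : Orthonormal ℝ e) : ‖wedge e‖ = 1 := by
  have h : ‖wedge e‖ ^ 2 = 1 := by
    rw [← real_inner_self_eq_norm_sq, inner_wedge_wedge]
    have : (Matrix.of fun i j => inner ℝ (e i) (e j)) = 1 := by
      ext i j
      simp [orthonormal_iff_ite.1 he i j, Matrix.one_apply]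
    rw [this, Matrix.det_one]
  exact (sq_eq_sq₀ (norm_nonneg _) zero_le_one).1 (by simpa using h)

/-- A unit simple `k`-vector is the wedge product of an orthonormal frame. -/
theorem exists_orthonormal_wedge_eq (hk : 1 ≤ k) {ω : KVec n k} (hω : ω ∈ unitSimple n k) :
    ∃ e : Fin k → Vec n, Orthonormal ℝ e ∧ wedge e = ω := by
  obtain ⟨⟨v, rfl⟩, hnorm⟩ := hω
  have hv : LinearIndependent ℝ v := (wedge_ne_zero_iff v).1 (norm_ne_zero_iff.1 (by simp [hnorm]))
  have hdim : Module.finrank ℝ (Submodule.span ℝ (range v)) = k := by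
    simpa using finrank_span_eq_card hv
  let b := (stdOrthonormalBasis ℝ (Submodule.span ℝ (range v))).reindex (finCongr hdim)
  let e : Fin k → Vec n := fun i => b i
  have he : Orthonormal ℝ e :=
    b.orthonormal.comp_linearIsometry (Submodule.span ℝ (range v)).subtypeₗᵢ
  let G : Matrix (Fin k) (Fin k) ℝ :=
    Matrix.of fun i j => inner ℝ (b j) ⟨v i, Submodule.subset_span (mem_range_self i)⟩
  have hvG : v = fun i => ∑ j, G i j • e j := by
    ext1 i
    have := b.sum_repr' ⟨v i, Submodule.subset_span (mem_range_self i)⟩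
    have h2 := congrArg (Subtype.val) this
    simp only [Submodule.coe_sum, Submodule.coe_smul] at h2
    exact h2.symm
  have hw : wedge v = G.det • wedge e := by
    conv_lhs => rw [hvG]
    exact wedge_sum_smul G e
  have hdet : |G.det| = 1 := by
    rw [hw, norm_smul, norm_wedge_of_orthonormal he, mul_one] at hnorm
    exact hnorm
  -- The first vector is multiplied by the sign `G.det`.
  let c : Fin k → ℝ := fun i => if i = ⟨0, hk⟩ then G.det else 1
  have hc : ∀ i, |c i| = 1 := fun i => by
    simp only [c]
    split_ifs
    · exact hdet
    · simp
  refine ⟨fun i => c i • e i, ⟨fun i => ?_, fun i j hij => ?_⟩, ?_⟩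
  · rw [norm_smul, he.1 i, Real.norm_eq_abs, hc, mul_one]
  · simp only [inner_smul_left, inner_smul_right, he.2 hij, mul_zero]
  · have h1 := (wedgeMultilinear n k).map_smul_univ c e
    simp only [wedgeMultilinear_apply] at h1
    rw [h1, hw]
    congr 1
    simp [c, Finset.prod_ite_eq']

theorem wedge_mem_unitSimple {e : Fin k → Vec n} (he : Orthonormal ℝ e) :
    wedge e ∈ unitSimple n k := ⟨⟨e, rfl⟩, norm_wedge_of_orthonormal he⟩

theorem space_wedge_of_orthonormal {e : Fin k → Vec n} (he : Orthonormal ℝ e) :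
    space (wedge e) = Submodule.span ℝ (range e) :=
  space_wedge ((wedge_ne_zero_iff e).2 he.linearIndependent)

/-- Cramer's rule for a frame `v` dual to `e`. -/
theorem inner_wedge_update {v e : Fin k → Vec n}
    (hve : ∀ p q, inner ℝ (v p) (e q) = if p = q then 1 else 0) (i : Fin k) (w : Vec n) :
    inner ℝ (wedge v) (wedge (Function.update e i w)) = inner ℝ (v i) w := by
  have h : (Matrix.of fun p q => inner ℝ (v p) (Function.update e i w q))
      = (1 : Matrix (Fin k) (Fin k) ℝ).updateCol i fun p => inner ℝ (v p) w := by
    ext p q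
    rcases eq_or_ne q i with rfl | hq
    · simp
    · simp [hq, hve, Matrix.one_apply]
  rw [inner_wedge_wedge, h, ← Matrix.cramer_apply, Matrix.cramer_one]
  rfl

theorem inner_wedge_of_dual {v e : Fin k → Vec n}
    (hve : ∀ p q, inner ℝ (v p) (e q) = if p = q then 1 else 0) :
    inner ℝ (wedge v) (wedge e) = 1 := by
  rw [inner_wedge_wedge]
  have : (Matrix.of fun p q => inner ℝ (v p) (e q)) = (1 : Matrix (Fin k) (Fin k) ℝ) := by
    ext p q
    simp [hve, Matrix.one_apply]
  rw [this, Matrix.det_one]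

theorem inner_wedge_update_wedge_update {e : Fin k → Vec n} (he : Orthonormal ℝ e) {c c' : Vec n}
    (hc : ∀ j, inner ℝ (e j) c = 0) (hc' : ∀ j, inner ℝ (e j) c' = 0) (i i' : Fin k) :
    inner ℝ (wedge (Function.update e i c)) (wedge (Function.update e i' c')) =
      if i = i' then inner ℝ c c' else 0 := by
  have he' := orthonormal_iff_ite.1 he
  rw [inner_wedge_wedge]
  by_cases hii : i = i'
  · subst hii
    have h : (Matrix.of fun p q => inner ℝ (Function.update e i c p) (Function.update e i c' q))
        = (1 : Matrix (Fin k) (Fin k) ℝ).updateCol i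
          fun p => if p = i then inner ℝ c c' else 0 := by
      ext p q
      by_cases hq : q = i <;> by_cases hp : p = i
      · simp [hq, hp]
      · simp [hq, hp, hc']
      · have : inner ℝ c (e q) = 0 := by rw [real_inner_comm, hc]
        simp [hq, hp, this, Ne.symm hq]
      · simp [hq, hp, he', Matrix.one_apply]
    rw [h, ← Matrix.cramer_apply, Matrix.cramer_one]
    simp
  · rw [if_neg hii]
    refine Matrix.det_eq_zero_of_row_eq_zero i' fun q => ?_
    by_cases hq : q = i'
    · simp [Ne.symm hii, hq, hc']
    · simp [Ne.symm hii, hq, he', Ne.symm hq]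

/-- The tangent vector at `wedge e` of the simple `k`-vectors `wedge (e + t c)` has the Euclidean
norm of `c`. -/
theorem norm_sum_wedge_update_sq {e : Fin k → Vec n} (he : Orthonormal ℝ e) {c : Fin k → Vec n}
    (hc : ∀ i j, inner ℝ (e j) (c i) = 0) :
    ‖∑ i, wedge (Function.update e i (c i))‖ ^ 2 = ∑ i, ‖c i‖ ^ 2 := by
  rw [← real_inner_self_eq_norm_sq, sum_inner]
  refine Finset.sum_congr rfl fun i _ => ?_
  simp_rw [inner_sum, inner_wedge_update_wedge_update he (hc i) (hc _)]
  simp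

/-- A unit simple `k`-vector with positive component along `wedge e` is the normalization of
`wedge (e + c)` for a family `c` orthogonal to `e`. -/
theorem exists_eq_normalize_wedge_add {e : Fin k → Vec n} (he : Orthonormal ℝ e) {ω : KVec n k}
    (hω : ω ∈ unitSimple n k) (hpos : 0 < inner ℝ ω (wedge e)) :
    ∃ c : Fin k → Vec n, (∀ i j, inner ℝ (e j) (c i) = 0) ∧
      ω = ‖wedge (e + c)‖⁻¹ • wedge (e + c) ∧ space ω = Submodule.span ℝ (range (e + c)) ∧
      ∀ i w, (∀ j, inner ℝ (e j) w = 0) →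
        inner ℝ (c i) w = inner ℝ ω (wedge (Function.update e i w)) / inner ℝ ω (wedge e) := by
  obtain ⟨⟨v, rfl⟩, hnorm⟩ := hω
  have he' := orthonormal_iff_ite.1 he
  set G : Matrix (Fin k) (Fin k) ℝ := Matrix.of fun i j => inner ℝ (v i) (e j) with hG
  have hGdet : inner ℝ (wedge v) (wedge e) = G.det := inner_wedge_wedge v e
  rw [hGdet] at hpos
  have hunit : IsUnit G.det := isUnit_iff_ne_zero.2 hpos.ne'
  let v' : Fin k → Vec n := fun i => ∑ j, G⁻¹ i j • v j
  have hv'e : ∀ p q, inner ℝ (v' p) (e q) = if p = q then 1 else 0 := by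
    intro p q
    have h1 : inner ℝ (v' p) (e q) = (G⁻¹ * G) p q := by
      simp only [v', sum_inner, real_inner_smul_left, Matrix.mul_apply, hG, Matrix.of_apply]
    rw [h1, Matrix.nonsing_inv_mul _ hunit, Matrix.one_apply]
  have hw : wedge v = G.det • wedge v' := by
    have h1 : wedge v' = G⁻¹.det • wedge v := wedge_sum_smul _ _
    rw [h1, smul_smul, Matrix.det_nonsing_inv, Ring.mul_inverse_cancel _ hunit, one_smul]
  have hv0 : wedge v ≠ 0 := norm_ne_zero_iff.1 (by simp [hnorm])
  have hv'0 : wedge v' ≠ 0 := fun h => hv0 (by rw [hw, h, smul_zero])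
  have hadd : e + (v' - e) = v' := add_sub_cancel e v'
  refine ⟨v' - e, fun i j => ?_, ?_, ?_, fun i w hw' => ?_⟩
  · rw [Pi.sub_apply, inner_sub_right, real_inner_comm, hv'e, he']
    simp [eq_comm]
  · rw [hadd]
    have h1 : G.det * ‖wedge v'‖ = 1 := by
      rw [hw, norm_smul, Real.norm_eq_abs, abs_of_pos hpos] at hnorm
      exact hnorm
    rw [hw, eq_inv_of_mul_eq_one_left h1]
  · rw [hadd, space_wedge hv0]
    -- Both spans are `k`-dimensional, and the second is contained in the first.
    symm
    refine Submodule.eq_of_le_of_finrank_eq ?_ ?_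
    · rw [Submodule.span_le]
      rintro _ ⟨i, rfl⟩
      exact Submodule.sum_mem _ fun j _ => Submodule.smul_mem _ _
        (Submodule.subset_span (mem_range_self j))
    · rw [finrank_span_eq_card ((wedge_ne_zero_iff v).1 hv0),
        finrank_span_eq_card ((wedge_ne_zero_iff v').1 hv'0)]
  · rw [hGdet, hw, inner_smul_left_kvec, inner_wedge_update hv'e, Pi.sub_apply,
      inner_sub_left, hw' i, sub_zero]
    simp [mul_div_cancel_left₀ _ hpos.ne']

theorem hasStrictFDerivAt_wedge_add {V : Type*} [NormedAddCommGroup V] [NormedSpace ℝ V]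
    (e : Fin k → Vec n) (c : V →L[ℝ] (Fin k → Vec n)) :
    HasStrictFDerivAt (fun x => wedge (e + c x))
      (((wedgeMultilinear n k).linearDeriv e).comp c) 0 := by
  have h1 : HasStrictFDerivAt (fun x => e + c x) c 0 := c.hasStrictFDerivAt.const_add e
  have h2 := (wedgeMultilinear n k).hasStrictFDerivAt (e + c 0)
  have h3 := h2.comp (0 : V) h1
  simp only [map_zero, add_zero] at h3
  exact h3

/-- Normalization does not change the derivative at a unit vector if the derivative is orthogonal
to that vector. -/
theorem _root_.HasStrictFDerivAt.normalize {V F : Type*} [NormedAddCommGroup V] [NormedSpace ℝ V]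
    [NormedAddCommGroup F] [InnerProductSpace ℝ F] {h : V → F} {h' : V →L[ℝ] F} {x : V}
    (hh : HasStrictFDerivAt h h' x) (hx : ‖h x‖ = 1) (horth : ∀ v, inner ℝ (h x) (h' v) = 0) :
    HasStrictFDerivAt (fun y => ‖h y‖⁻¹ • h y) h' x := by
  have h0 : h x ≠ 0 := norm_ne_zero_iff.1 (by simp [hx])
  have h1 : HasStrictFDerivAt (fun y => ‖h y‖ ^ 2) (0 : V →L[ℝ] ℝ) x := by
    have := (hasStrictFDerivAt_norm_sq (h x)).comp x hh
    convert! this using 1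
    ext v
    simp [horth]
  have h2 : HasStrictFDerivAt (fun y => ‖h y‖⁻¹) (0 : V →L[ℝ] ℝ) x := by
    have h3 : HasStrictFDerivAt (fun y => (Real.sqrt (‖h y‖ ^ 2))⁻¹) (0 : V →L[ℝ] ℝ) x := by
      have h4 := h1.sqrt (by simp [hx])
      have h5 := (hasStrictDerivAt_inv (x := Real.sqrt (‖h x‖ ^ 2))
        (by simp [hx])).comp_hasStrictFDerivAt x h4
      convert! h5 using 1
      simp
    simpa using h3
  have h6 := h2.smul hh
  convert! h6 using 1
  ext v
  simp [hx]

end Wedge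

/-! ### Manifolds in straightening charts -/

section Manifold

variable {n k : ℕ}

/-- The `k`-dimensional coordinate subspace of `ℝⁿ`. -/
def coordSubspace (n k : ℕ) : Submodule ℝ (Vec n) where
  carrier := {w | ∀ i : Fin n, k ≤ (i : ℕ) → w i = 0}
  add_mem' ha hb i hi := by simp [ha i hi, hb i hi]
  zero_mem' i _ := rfl
  smul_mem' c a ha i hi := by simp [ha i hi]

theorem eq_sum_of_mem_coordSubspace (hkn : k ≤ n) {w : Vec n} (hw : w ∈ coordSubspace n k) :
    w = ∑ i : Fin k, w (Fin.castLE hkn i) • EuclideanSpace.single (Fin.castLE hkn i) (1 : ℝ) := by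
  ext j
  simp only [WithLp.ofLp_sum, WithLp.ofLp_smul, Finset.sum_apply, Pi.smul_apply, smul_eq_mul,
    PiLp.single_apply]
  by_cases hj : (j : ℕ) < k
  · rw [Finset.sum_eq_single ⟨j, hj⟩]
    · simp [Fin.castLE]
    · intro b _ hb
      have : j ≠ Fin.castLE hkn b := fun h => hb (Fin.ext (by simp [h]))
      simp [this]
    · simp
  · rw [hw j (not_lt.1 hj), eq_comm]
    refine Finset.sum_eq_zero fun b _ => ?_
    have : j ≠ Fin.castLE hkn b := fun h => hj (by simp [h])
    simp [this]

theorem single_mem_coordSubspace (hkn : k ≤ n) (i : Fin k) :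
    EuclideanSpace.single (Fin.castLE hkn i) (1 : ℝ) ∈ coordSubspace n k := by
  intro j hj
  have : j ≠ Fin.castLE hkn i := fun h => by
    rw [h] at hj
    exact absurd i.2 (not_lt.2 (by simpa using hj))
  simp [this]

theorem finrank_coordSubspace (hkn : k ≤ n) : Module.finrank ℝ (coordSubspace n k) = k := by
  have hon : Orthonormal ℝ fun i : Fin k => EuclideanSpace.single (Fin.castLE hkn i) (1 : ℝ) :=
    (EuclideanSpace.orthonormal_single (𝕜 := ℝ) (ι := Fin n)).comp _ (Fin.castLE_injective hkn)
  have hspan : coordSubspace n k =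
      Submodule.span ℝ
        (range fun i : Fin k => EuclideanSpace.single (Fin.castLE hkn i) (1 : ℝ)) := by
    refine le_antisymm (fun w hw => ?_) ?_
    · rw [eq_sum_of_mem_coordSubspace hkn hw]
      exact Submodule.sum_mem _ fun i _ =>
        Submodule.smul_mem _ _ (Submodule.subset_span (mem_range_self i))
    · rw [Submodule.span_le]
      rintro _ ⟨i, rfl⟩
      exact single_mem_coordSubspace hkn i
  rw [hspan, finrank_span_eq_card hon.linearIndependent, Fintype.card_fin]

variable {Φ : OpenPartialHomeomorph (Vec n) (Vec n)}

theorem fderiv_symm_fderiv (hΦ : ContDiffOn ℝ 1 Φ Φ.source) (hΦ' : ContDiffOn ℝ 1 Φ.symm Φ.target)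
    {z : Vec n} (hz : z ∈ Φ.source) (v : Vec n) :
    fderiv ℝ Φ.symm (Φ z) (fderiv ℝ Φ z v) = v := by
  have h1 : HasFDerivAt Φ (fderiv ℝ Φ z) z :=
    ((hΦ.contDiffAt (Φ.open_source.mem_nhds hz)).differentiableAt one_ne_zero).hasFDerivAt
  have h2 : HasFDerivAt Φ.symm (fderiv ℝ Φ.symm (Φ z)) (Φ z) :=
    ((hΦ'.contDiffAt (Φ.open_target.mem_nhds (Φ.map_source hz))).differentiableAt
      one_ne_zero).hasFDerivAt
  have h3 := h2.comp z h1
  have h4 : HasFDerivAt (Φ.symm ∘ Φ) (ContinuousLinearMap.id ℝ (Vec n)) z := by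
    refine (hasFDerivAt_id z).congr_of_eventuallyEq ?_
    filter_upwards [Φ.open_source.mem_nhds hz] with y hy
    exact Φ.left_inv hy
  exact congrArg (fun L : Vec n →L[ℝ] Vec n => L v) (h3.unique h4)

theorem injective_fderiv_symm (hΦ : ContDiffOn ℝ 1 Φ Φ.source)
    (hΦ' : ContDiffOn ℝ 1 Φ.symm Φ.target) {z : Vec n} (hz : z ∈ Φ.source) :
    Function.Injective (fderiv ℝ Φ.symm (Φ z)) := by
  have hsurj : Function.Surjective (fderiv ℝ Φ.symm (Φ z) : Vec n →ₗ[ℝ] Vec n) := fun v =>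
    ⟨_, fderiv_symm_fderiv hΦ hΦ' hz v⟩
  exact LinearMap.injective_iff_surjective.2 hsurj

/-- If `u` is an orthonormal frame which the straightening chart `Φ` maps to the coordinate subspace
at `z₀`, then the part near `z₀` of a set straightened by `Φ` has a parametrization `γ` with partial
derivatives `u` at `0`, with inverse `κ`. -/
theorem exists_parametrization (hkn : k ≤ n) (hΦ : ContDiffOn ℝ 1 Φ Φ.source)
    (hΦ' : ContDiffOn ℝ 1 Φ.symm Φ.target) {z₀ : Vec n} (hz₀ : z₀ ∈ Φ.source)
    (hz₀' : Φ z₀ ∈ coordSubspace n k) {S : Set (Vec n)}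
    (hS : ∀ y ∈ Φ.source, y ∈ S → Φ y ∈ coordSubspace n k) {u : Fin k → Vec n}
    (hu : Orthonormal ℝ u) (huΦ : ∀ j, fderiv ℝ Φ z₀ (u j) ∈ coordSubspace n k) :
    ∃ (γ : (Fin k → ℝ) → Vec n) (γ' : (Fin k → ℝ) →L[ℝ] Vec n) (κ : Vec n → Fin k → ℝ),
      γ 0 = z₀ ∧ HasStrictFDerivAt γ γ' 0 ∧ (∀ t, γ' t = ∑ j, t j • u j) ∧
      Tendsto κ (𝓝 z₀) (𝓝 0) ∧ ∀ᶠ z in 𝓝[S] z₀, γ (κ z) = z := by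
  set T := fderiv ℝ Φ z₀ with hT
  set T' := fderiv ℝ Φ.symm (Φ z₀) with hT'
  let U : (Fin k → ℝ) →L[ℝ] Vec n := (Fintype.linearCombination ℝ u).toContinuousLinearMap
  have hU : ∀ t, U t = ∑ j, t j • u j := fun t => by
    simp [U, Fintype.linearCombination_apply]
  have hT'T : ∀ v, T' (T v) = v := fderiv_symm_fderiv hΦ hΦ' hz₀
  have hmap : (Submodule.span ℝ (range u)).map (T : Vec n →ₗ[ℝ] Vec n) = coordSubspace n k := by
    refine Submodule.eq_of_le_of_finrank_le ?_ ?_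
    · rw [Submodule.map_span, Submodule.span_le]
      rintro _ ⟨_, ⟨j, rfl⟩, rfl⟩
      exact huΦ j
    · have hTinj : Function.Injective (T : Vec n →ₗ[ℝ] Vec n) := Function.LeftInverse.injective hT'T
      rw [finrank_coordSubspace hkn, ← (Submodule.equivMapOfInjective _ hTinj _).finrank_eq,
        finrank_span_eq_card hu.linearIndependent, Fintype.card_fin]
  have hγ : HasStrictFDerivAt (fun t => Φ z₀ + T (U t)) (T.comp U) 0 :=
    (T.comp U).hasStrictFDerivAt.const_add _
  have hsymm : HasStrictFDerivAt Φ.symm T' (Φ z₀ + T (U 0)) := by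
    simpa using (hΦ'.contDiffAt (Φ.open_target.mem_nhds (Φ.map_source hz₀))).hasStrictFDerivAt
      one_ne_zero
  refine ⟨fun t => Φ.symm (Φ z₀ + T (U t)), U, fun z j => inner ℝ (u j) (T' (Φ z - Φ z₀)), ?_, ?_,
    hU, ?_, ?_⟩
  · simp [Φ.left_inv hz₀]
  · convert! hsymm.comp 0 hγ using 1
    ext1 t
    exact (hT'T _).symm
  · refine tendsto_pi_nhds.2 fun j => ?_
    have : ContinuousAt (fun z => inner ℝ (u j) (T' (Φ z - Φ z₀))) z₀ :=
      continuousAt_const.inner (𝕜 := ℝ) (T'.continuous.continuousAt.comp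
        ((Φ.continuousAt hz₀).sub continuousAt_const))
    simpa [ContinuousAt] using this
  · filter_upwards [mem_nhdsWithin_of_mem_nhds (Φ.open_source.mem_nhds hz₀), self_mem_nhdsWithin]
      with z hz hzS
    have hw : Φ z - Φ z₀ ∈ coordSubspace n k := Submodule.sub_mem _ (hS z hz hzS) hz₀'
    rw [← hmap] at hw
    obtain ⟨v, hv, hvw⟩ := hw
    obtain ⟨c, rfl⟩ := (Submodule.mem_span_range_iff_exists_fun ℝ).1 hv
    have hvw' : T (∑ j, c j • u j) = Φ z - Φ z₀ := hvw
    have hc : (fun j => inner ℝ (u j) (T' (Φ z - Φ z₀))) = c := by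
      ext1 j
      rw [← hvw', hT'T]
      exact hu.inner_right_fintype c j
    simp only [hc]
    rw [hU, hvw', add_sub_cancel, Φ.left_inv hz]

theorem fderiv_mem_coordSubspace (hΦ : ContDiffOn ℝ 1 Φ Φ.source) {z : Vec n} (hz : z ∈ Φ.source)
    {M : Set (Vec n)} (hM : ∀ y ∈ Φ.source, y ∈ M → Φ y ∈ coordSubspace n k) {v : Vec n}
    (hv : v ∈ tangentSet M z) : fderiv ℝ Φ z v ∈ coordSubspace n k := by
  obtain ⟨γ, rfl, hγM, hγ⟩ := hv
  have h1 : HasFDerivAt Φ (fderiv ℝ Φ (γ 0)) (γ 0) :=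
    ((hΦ.contDiffAt (Φ.open_source.mem_nhds hz)).differentiableAt one_ne_zero).hasFDerivAt
  have h2 : HasDerivAt (fun t => Φ (γ t)) (fderiv ℝ Φ (γ 0) v) 0 := h1.comp_hasDerivAt 0 hγ
  intro i hi
  have h3 : HasDerivAt (fun t => Φ (γ t) i) (fderiv ℝ Φ (γ 0) v i) 0 :=
    (EuclideanSpace.proj (𝕜 := ℝ) i).hasFDerivAt.comp_hasDerivAt 0 h2
  have h4 : HasDerivAt (fun t => Φ (γ t) i) 0 0 := by
    refine (hasDerivAt_const 0 (0 : ℝ)).congr_of_eventuallyEq ?_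
    filter_upwards [hγM, hγ.continuousAt.eventually (Φ.open_source.mem_nhds hz)] with t ht ht'
    exact hM _ ht' ht i hi
  exact h3.unique h4

/-- The sign of `vol` is not continuous, but the absolute values of its components are. -/
theorem continuousOn_abs_inner_vol (hk : 1 ≤ k) (hkn : k ≤ n) {M : Set (Vec n)}
    (hM : IsBoundedManifold k M) {vol : Vec n → KVec n k} (hvol : IsVolumeForm M vol) :
    ContinuousOn (fun p : Vec n × KVec n k => |inner ℝ (vol p.1) p.2|) (M ×ˢ univ) := by
  rintro ⟨z₀, ω₀⟩ ⟨hz₀, -⟩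
  obtain ⟨Φ, hzΦ, hΦ, hΦ', hΦM⟩ := hM.interior_chart z₀ hz₀
  let w : Vec n → Fin k → Vec n := fun z i =>
    fderiv ℝ Φ.symm (Φ z) (EuclideanSpace.single (Fin.castLE hkn i) (1 : ℝ))
  have hwcont : ContinuousAt w z₀ := by
    refine continuousAt_pi.2 fun i => ?_
    have h1 : ContinuousAt (fderiv ℝ Φ.symm) (Φ z₀) :=
      (hΦ'.continuousOn_fderiv_of_isOpen Φ.open_target le_rfl).continuousAt
        (Φ.open_target.mem_nhds (Φ.map_source hzΦ))
    exact (ContinuousAt.comp (f := Φ) h1 (Φ.continuousAt hzΦ)).clm_apply continuousAt_const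
  have key : ∀ z ∈ Φ.source, z ∈ M → wedge (w z) ≠ 0 ∧
      ∀ ω, |inner ℝ (vol z) ω| = |inner ℝ (wedge (w z)) ω| / ‖wedge (w z)‖ := by
    intro z hz hzM
    obtain ⟨u, hu, huv⟩ := exists_orthonormal_wedge_eq hk (hvol z hzM).1
    have hut : ∀ j, u j ∈ tangentSet M z := fun j => by
      rw [← (hvol z hzM).2, ← huv, space_wedge_of_orthonormal hu]
      exact Submodule.subset_span (mem_range_self j)
    let G : Matrix (Fin k) (Fin k) ℝ := Matrix.of fun j i => fderiv ℝ Φ z (u j) (Fin.castLE hkn i)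
    have huG : u = fun j => ∑ i, G j i • w z i := by
      ext1 j
      have h1 := fderiv_mem_coordSubspace hΦ hz (fun y hy hyM => (hΦM y hy).1 hyM) (hut j)
      have h2 := congrArg (fderiv ℝ Φ.symm (Φ z)) (eq_sum_of_mem_coordSubspace hkn h1)
      rw [fderiv_symm_fderiv hΦ hΦ' hz, map_sum] at h2
      simp_rw [map_smul] at h2
      exact h2
    have hvG : vol z = G.det • wedge (w z) := by
      rw [← huv]
      conv_lhs => rw [huG]
      exact wedge_sum_smul _ _
    have hnorm : |G.det| * ‖wedge (w z)‖ = 1 := by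
      have := (hvol z hzM).1.2
      rwa [hvG, norm_smul, Real.norm_eq_abs] at this
    have hw0 : wedge (w z) ≠ 0 := fun h => by simp [h] at hnorm
    refine ⟨hw0, fun ω => ?_⟩
    rw [hvG, inner_smul_left_kvec, abs_mul, eq_div_iff (norm_ne_zero_iff.2 hw0), mul_right_comm,
      hnorm, one_mul]
  have hcont : ContinuousAt (fun p : Vec n × KVec n k =>
      |inner ℝ (wedge (w p.1)) p.2| / ‖wedge (w p.1)‖) (z₀, ω₀) := by
    have h1 : ContinuousAt (fun p : Vec n × KVec n k => wedge (w p.1)) (z₀, ω₀) :=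
      continuous_wedge.continuousAt.comp
        (ContinuousAt.comp (g := w) (f := Prod.fst) hwcont continuousAt_fst)
    exact (h1.inner (𝕜 := ℝ) continuousAt_snd).abs.div h1.norm
      (norm_ne_zero_iff.2 (key z₀ hzΦ hz₀).1)
  refine hcont.continuousWithinAt.congr_of_eventuallyEq ?_ ((key z₀ hzΦ hz₀).2 ω₀)
  have hmem : ∀ᶠ p : Vec n × KVec n k in 𝓝 (z₀, ω₀), p.1 ∈ Φ.source :=
    continuousAt_fst.eventually (Φ.open_source.mem_nhds hzΦ)
  filter_upwards [mem_nhdsWithin_of_mem_nhds hmem, self_mem_nhdsWithin] with p hp hpM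
  exact (key p.1 hp hpM.1).2 p.2

end Manifold

/-! ### Model space and adapted frames -/

/-- Index of an orthonormal basis of `ℝⁿ` adapted to `(a, ω) ∈ 𝒲`: a basis of `[ω]`, the vector `a`
and a basis of the rest. -/
abbrev FrameIdx (k m : ℕ) : Type := Fin k ⊕ (Unit ⊕ Fin m)

/-- Index of the coordinates of the parameter space. In this order they are: the slopes of `[ω]` in
the direction `a`, the coordinates on the manifold, the displacements of `a` orthogonal to `[ω]`,
the slopes of `[ω]` in the directions orthogonal to `a`, and the increments of `ξ` and `r`. -/
abbrev ModelIdx (k m : ℕ) : Type :=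
  Fin k ⊕ (Fin k ⊕ (Fin m ⊕ ((Fin k × Fin m) ⊕ (Unit ⊕ Unit))))

/-- The Euclidean space which serves as a model both for the parameters and for the disks. -/
abbrev Model (k m : ℕ) : Type := EuclideanSpace ℝ (ModelIdx k m)

theorem finrank_model (k m : ℕ) :
    Module.finrank ℝ (Model k m) = (k + 1 + m) + k * (k + 1 + m - k) + 1 := by
  have : k + 1 + m - k = 1 + m := by omega
  rw [finrank_euclideanSpace, this]
  simp only [Fintype.card_sum, Fintype.card_prod, Fintype.card_fin, Fintype.card_unit]
  ring

/-- A block triangular determinant. -/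
theorem det_of_blockTriangular {ι₁ ι₂ ι₃ : Type*} [Fintype ι₁] [Fintype ι₂] [Fintype ι₃]
    [DecidableEq ι₁] [DecidableEq ι₂] [DecidableEq ι₃]
    (L : EuclideanSpace ℝ (ι₁ ⊕ (ι₂ ⊕ ι₃)) →L[ℝ] EuclideanSpace ℝ (ι₁ ⊕ (ι₂ ⊕ ι₃)))
    (σ : ℝ) (G : Matrix ι₂ ι₂ ℝ) (d : ι₃ → ℝ)
    (h₁ : ∀ x i, L x (Sum.inl i) = σ * x (Sum.inl i))
    (h₂ : ∀ x, (∀ i, x (Sum.inl i) = 0) →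
      ∀ i, L x (Sum.inr (Sum.inl i)) = ∑ p, x (Sum.inr (Sum.inl p)) * G i p)
    (h₃ : ∀ x, (∀ i, x (Sum.inl i) = 0) → (∀ i, x (Sum.inr (Sum.inl i)) = 0) →
      ∀ i, L x (Sum.inr (Sum.inr i)) = d i * x (Sum.inr (Sum.inr i))) :
    L.det = σ ^ Fintype.card ι₁ * (G.det * ∏ i, d i) := by
  let b := (EuclideanSpace.basisFun (ι₁ ⊕ (ι₂ ⊕ ι₃)) ℝ).toBasis
  let A : Matrix (ι₁ ⊕ (ι₂ ⊕ ι₃)) (ι₁ ⊕ (ι₂ ⊕ ι₃)) ℝ := LinearMap.toMatrix b b L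
  have hA : ∀ i j, A i j = L (EuclideanSpace.single j 1) i := fun i j => by
    simp [A, b, LinearMap.toMatrix_apply]
  have h11 : A.toBlocks₁₁ = Matrix.diagonal fun _ => σ := by
    ext i j
    simp [Matrix.toBlocks₁₁, hA, h₁, Matrix.diagonal_apply]
  have h12 : A.toBlocks₁₂ = 0 := by
    ext i j
    simp [Matrix.toBlocks₁₂, hA, h₁]
  have h22 : A.toBlocks₂₂ = Matrix.fromBlocks G 0 A.toBlocks₂₂.toBlocks₂₁ (Matrix.diagonal d) := by
    rw [← Matrix.fromBlocks_toBlocks A.toBlocks₂₂]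
    congr 1
    · ext i j
      simp [Matrix.toBlocks₂₂, Matrix.toBlocks₁₁, hA, h₂]
    · ext i j
      simp [Matrix.toBlocks₂₂, Matrix.toBlocks₁₂, hA, h₂]
    · ext i j
      simp [Matrix.toBlocks₂₂, hA, h₃, Matrix.diagonal_apply]
  calc L.det = A.det := (LinearMap.det_toMatrix b (L : _ →ₗ[ℝ] _)).symm
    _ = (Matrix.fromBlocks (Matrix.diagonal fun _ => σ) 0 A.toBlocks₂₁ A.toBlocks₂₂).det := by
        rw [← h11, ← h12, Matrix.fromBlocks_toBlocks]
    _ = _ := by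
        rw [Matrix.det_fromBlocks_zero₁₂, h22, Matrix.det_fromBlocks_zero₁₂]
        simp

theorem _root_.Orthonormal.norm_sum_smul_sq {E ι : Type*} [NormedAddCommGroup E]
    [InnerProductSpace ℝ E] [Fintype ι] {v : ι → E} (hv : Orthonormal ℝ v) (x : ι → ℝ) :
    ‖∑ i, x i • v i‖ ^ 2 = ∑ i, x i ^ 2 := by
  rw [← real_inner_self_eq_norm_sq, hv.inner_sum]
  simp [sq]

/-- The pair of two continuous linear maps, with values in the Euclidean product. -/
noncomputable def lpProd {V E F : Type*} [NormedAddCommGroup V] [NormedSpace ℝ V]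
    [NormedAddCommGroup E] [NormedSpace ℝ E] [NormedAddCommGroup F] [NormedSpace ℝ F]
    (f : V →L[ℝ] E) (g : V →L[ℝ] F) : V →L[ℝ] WithLp 2 (E × F) :=
  ((WithLp.prodContinuousLinearEquiv 2 ℝ E F).symm : E × F →L[ℝ] WithLp 2 (E × F)).comp (f.prod g)

theorem norm_lpProd_sq {V E F : Type*} [NormedAddCommGroup V] [NormedSpace ℝ V]
    [NormedAddCommGroup E] [NormedSpace ℝ E] [NormedAddCommGroup F] [NormedSpace ℝ F]
    (f : V →L[ℝ] E) (g : V →L[ℝ] F) (v : V) : ‖lpProd f g v‖ ^ 2 = ‖f v‖ ^ 2 + ‖g v‖ ^ 2 :=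
  WithLp.prod_norm_sq_eq_of_L2 _

theorem _root_.HasStrictFDerivAt.toLp_prodMk {V E F : Type*} [NormedAddCommGroup V]
    [NormedSpace ℝ V] [NormedAddCommGroup E] [NormedSpace ℝ E] [NormedAddCommGroup F]
    [NormedSpace ℝ F] {f : V → E} {g : V → F} {f' : V →L[ℝ] E} {g' : V →L[ℝ] F} {x : V}
    (hf : HasStrictFDerivAt f f' x) (hg : HasStrictFDerivAt g g' x) :
    HasStrictFDerivAt (fun y => WithLp.toLp 2 (f y, g y)) (lpProd f' g') x :=
  ((WithLp.prodContinuousLinearEquiv 2 ℝ E F).symm : E × F →L[ℝ] WithLp 2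
    (E × F)).hasStrictFDerivAt.comp x (hf.prodMk hg)

section Frame

variable {n k m : ℕ} (b : OrthonormalBasis (FrameIdx k m) ℝ (Vec n))

/-- The linear combination of the frame with the given coefficients. -/
noncomputable def combine : (FrameIdx k m → ℝ) →L[ℝ] Vec n :=
  (Fintype.linearCombination ℝ b).toContinuousLinearMap

theorem combine_apply (x : FrameIdx k m → ℝ) : combine b x = ∑ i, x i • b i := by
  simp [combine, Fintype.linearCombination_apply]

theorem inner_combine (x : FrameIdx k m → ℝ) (i : FrameIdx k m) :
    inner ℝ (b i) (combine b x) = x i := by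
  rw [combine_apply]
  exact b.orthonormal.inner_right_fintype x i

theorem norm_combine_sq (x : FrameIdx k m → ℝ) : ‖combine b x‖ ^ 2 = ∑ i, x i ^ 2 := by
  rw [combine_apply, b.orthonormal.norm_sum_smul_sq]

theorem combine_inner (v : Vec n) : combine b (fun i => inner ℝ (b i) v) = v := by
  rw [combine_apply]
  exact b.sum_repr' v

/-- The part of the frame which spans the plane `[ω]`. -/
noncomputable def planeFrame : Fin k → Vec n := fun i => b (Sum.inl i)

/-- The vector of the frame in the direction `a`. -/
noncomputable def axis : Vec n := b (Sum.inr (Sum.inl ()))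

theorem orthonormal_planeFrame : Orthonormal ℝ (planeFrame b) :=
  b.orthonormal.comp _ Sum.inl_injective

/-- A coordinate of the model space. -/
noncomputable def coord (p : ModelIdx k m) : Model k m →L[ℝ] ℝ := EuclideanSpace.proj p

@[simp] theorem coord_apply (p : ModelIdx k m) (x : Model k m) : coord p x = x p := rfl

/-- The displacements of the vectors of `planeFrame b`. The factor `σ` rescales the slopes in the
direction `a`. -/
noncomputable def slope (σ : ℝ) : Model k m →L[ℝ] (Fin k → Vec n) :=
  ContinuousLinearMap.pi fun i => (combine b).comp (ContinuousLinearMap.pi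
    (Sum.elim (fun _ => 0) (Sum.elim (fun _ => σ • coord (Sum.inl i))
      (fun j => coord (Sum.inr (Sum.inr (Sum.inr (Sum.inl (i, j)))))))))

theorem slope_apply (σ : ℝ) (x : Model k m) (i : Fin k) :
    slope b σ x i = combine b (Sum.elim (fun _ => 0) (Sum.elim (fun _ => σ * x (Sum.inl i))
      (fun j => x (Sum.inr (Sum.inr (Sum.inr (Sum.inl (i, j)))))))) := by
  simp only [slope, ContinuousLinearMap.pi_apply, ContinuousLinearMap.comp_apply]
  congr 1
  ext p
  rcases p with p | p | p <;> simp

theorem inner_planeFrame_slope (σ : ℝ) (x : Model k m) (i j : Fin k) :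
    inner ℝ (planeFrame b j) (slope b σ x i) = 0 := by
  rw [slope_apply, planeFrame, inner_combine, Sum.elim_inl]

theorem norm_slope_sq (σ : ℝ) (x : Model k m) (i : Fin k) :
    ‖slope b σ x i‖ ^ 2 =
      σ ^ 2 * x (Sum.inl i) ^ 2 + ∑ j, x (Sum.inr (Sum.inr (Sum.inr (Sum.inl (i, j))))) ^ 2 := by
  rw [slope_apply, norm_combine_sq]
  simp [mul_pow]

/-- The displacement of the direction `a` inside the orthogonal complement of `[ω]`. -/
noncomputable def shift : Model k m →L[ℝ] Vec n :=
  (combine b).comp (ContinuousLinearMap.pi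
    (Sum.elim (fun _ => 0) (Sum.elim (fun _ => 0)
      (fun j => coord (Sum.inr (Sum.inr (Sum.inl j)))))))

theorem shift_apply (x : Model k m) :
    shift b x = combine b (Sum.elim (fun _ => 0) (Sum.elim (fun _ => 0)
      (fun j => x (Sum.inr (Sum.inr (Sum.inl j)))))) := by
  simp only [shift, ContinuousLinearMap.comp_apply]
  congr 1
  ext p
  rcases p with p | p | p <;> simp

/-- The unit simple `k`-vector of the plane spanned by the displaced frame. -/
noncomputable def tiltedPlane (σ : ℝ) (x : Model k m) : KVec n k :=
  ‖wedge (planeFrame b + slope b σ x)‖⁻¹ • wedge (planeFrame b + slope b σ x)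

/-- The tangent map of `tiltedPlane` at `0`. -/
noncomputable def tiltedPlaneDeriv (σ : ℝ) : Model k m →L[ℝ] KVec n k :=
  ((wedgeMultilinear n k).linearDeriv (planeFrame b)).comp (slope b σ)

theorem tiltedPlaneDeriv_apply (σ : ℝ) (x : Model k m) :
    tiltedPlaneDeriv b σ x = ∑ i, wedge (Function.update (planeFrame b) i (slope b σ x i)) := by
  rw [tiltedPlaneDeriv, ContinuousLinearMap.comp_apply, ContinuousMultilinearMap.linearDeriv_apply]
  rfl

theorem norm_tiltedPlaneDeriv_sq (σ : ℝ) (x : Model k m) :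
    ‖tiltedPlaneDeriv b σ x‖ ^ 2 = ∑ i, (σ ^ 2 * x (Sum.inl i) ^ 2 +
      ∑ j, x (Sum.inr (Sum.inr (Sum.inr (Sum.inl (i, j))))) ^ 2) := by
  rw [tiltedPlaneDeriv_apply, norm_sum_wedge_update_sq (orthonormal_planeFrame b)
    (inner_planeFrame_slope b σ x)]
  simp_rw [norm_slope_sq]

theorem hasStrictFDerivAt_tiltedPlane (σ : ℝ) :
    HasStrictFDerivAt (tiltedPlane b σ) (tiltedPlaneDeriv b σ) 0 := by
  have he := orthonormal_planeFrame b
  refine (hasStrictFDerivAt_wedge_add (planeFrame b) (slope b σ)).normalize ?_ fun v => ?_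
  · simp [norm_wedge_of_orthonormal he]
  · have := tiltedPlaneDeriv_apply b σ v
    rw [tiltedPlaneDeriv] at this
    rw [this, inner_sum]
    refine Finset.sum_eq_zero fun i _ => ?_
    rw [map_zero, add_zero, inner_wedge_update (orthonormal_iff_ite.1 he),
      inner_planeFrame_slope]

/-- A vector orthogonal to the displaced plane, the direction of the displaced `a`. -/
noncomputable def tiltedAxis (σ : ℝ) (x : Model k m) : Vec n :=
  axis b + shift b x - ∑ i, inner ℝ (slope b σ x i) (axis b + shift b x) • planeFrame b i

/-- The tangent map of the normalization of `tiltedAxis` at `0`. -/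
noncomputable def tiltedAxisDeriv (σ : ℝ) : Model k m →L[ℝ] Vec n :=
  (combine b).comp (ContinuousLinearMap.pi
    (Sum.elim (fun i => -(σ • coord (Sum.inl i))) (Sum.elim (fun _ => 0)
      (fun j => coord (Sum.inr (Sum.inr (Sum.inl j)))))))

theorem tiltedAxisDeriv_apply (σ : ℝ) (x : Model k m) :
    tiltedAxisDeriv b σ x = combine b (Sum.elim (fun i => -(σ * x (Sum.inl i)))
      (Sum.elim (fun _ => 0) (fun j => x (Sum.inr (Sum.inr (Sum.inl j)))))) := by
  simp only [tiltedAxisDeriv, ContinuousLinearMap.comp_apply]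
  congr 1
  ext p
  rcases p with p | p | p <;> simp

theorem norm_tiltedAxisDeriv_sq (σ : ℝ) (x : Model k m) :
    ‖tiltedAxisDeriv b σ x‖ ^ 2 =
      ∑ i, σ ^ 2 * x (Sum.inl i) ^ 2 + ∑ j, x (Sum.inr (Sum.inr (Sum.inl j))) ^ 2 := by
  rw [tiltedAxisDeriv_apply, norm_combine_sq]
  simp [mul_pow]

theorem inner_slope_axis (σ : ℝ) (x : Model k m) (i : Fin k) :
    inner ℝ (slope b σ x i) (axis b) = σ * x (Sum.inl i) := by
  rw [real_inner_comm, slope_apply, axis, inner_combine, Sum.elim_inr, Sum.elim_inl]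

theorem hasStrictFDerivAt_normalize_tiltedAxis (σ : ℝ) :
    HasStrictFDerivAt (fun x => ‖tiltedAxis b σ x‖⁻¹ • tiltedAxis b σ x) (tiltedAxisDeriv b σ)
      0 := by
  have h0 : tiltedAxis b σ 0 = axis b := by simp [tiltedAxis]
  have hderiv : HasStrictFDerivAt (tiltedAxis b σ) (tiltedAxisDeriv b σ) 0 := by
    have h1 : HasStrictFDerivAt (fun x => axis b + shift b x) (shift b) 0 :=
      (shift b).hasStrictFDerivAt.const_add _
    have h2 : ∀ i, HasStrictFDerivAt (fun x => slope b σ x i)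
        ((ContinuousLinearMap.proj i).comp (slope b σ)) 0 := fun i =>
      ((ContinuousLinearMap.proj i).comp (slope b σ)).hasStrictFDerivAt
    have h3 := h1.sub (HasStrictFDerivAt.fun_sum (u := Finset.univ) fun i _ =>
      ((h2 i).inner ℝ h1).smul_const (planeFrame b i))
    refine h3.congr_fderiv ?_
    ext1 v
    simp only [_root_.sub_apply, _root_.sum_apply,
      ContinuousLinearMap.smulRight_apply, ContinuousLinearMap.comp_apply,
      ContinuousLinearMap.prod_apply, fderivInnerCLM_apply, ContinuousLinearMap.proj_apply,
      map_zero, Pi.zero_apply, inner_zero_left, zero_add, add_zero, inner_slope_axis]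
    rw [tiltedAxisDeriv_apply, shift_apply, combine_apply, combine_apply, Fintype.sum_sum_type,
      Fintype.sum_sum_type]
    simp [planeFrame, neg_smul, Finset.sum_neg_distrib]
    abel
  refine hderiv.normalize ?_ fun v => ?_
  · rw [h0]
    exact b.orthonormal.1 _
  · rw [h0, tiltedAxisDeriv_apply, axis, inner_combine, Sum.elim_inr, Sum.elim_inl]

end Frame

/-! ### Charts of the parameter space and of the space of disks -/

section ParamChart

variable {n k m : ℕ} (b : OrthonormalBasis (FrameIdx k m) ℝ (Vec n))

/-- The coordinates on the manifold. -/
noncomputable def manifoldCoord (k m : ℕ) : Model k m →L[ℝ] (Fin k → ℝ) :=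
  ContinuousLinearMap.pi fun i => coord (Sum.inr (Sum.inl i))

/-- The increment of `ξ`. -/
noncomputable def distCoord (k m : ℕ) : Model k m →L[ℝ] ℝ :=
  coord (Sum.inr (Sum.inr (Sum.inr (Sum.inr (Sum.inl ())))))

/-- The increment of `r`. -/
noncomputable def radiusCoord (k m : ℕ) : Model k m →L[ℝ] ℝ :=
  coord (Sum.inr (Sum.inr (Sum.inr (Sum.inr (Sum.inr ())))))

theorem norm_model_sq (x : Model k m) :
    ‖x‖ ^ 2 = ∑ i, x (Sum.inl i) ^ 2 + (∑ i, x (Sum.inr (Sum.inl i)) ^ 2 +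
      (∑ j, x (Sum.inr (Sum.inr (Sum.inl j))) ^ 2 +
        (∑ i, ∑ j, x (Sum.inr (Sum.inr (Sum.inr (Sum.inl (i, j))))) ^ 2 +
          (distCoord k m x ^ 2 + radiusCoord k m x ^ 2)))) := by
  rw [EuclideanSpace.norm_sq_eq]
  simp [Fintype.sum_prod_type, distCoord, radiusCoord]

/-- The chart of the set of the parameters `(z, a, ω, ξ, r)`. The slopes in the direction `a` occur
twice in its derivative, as a motion of `ω` and as a motion of `a`: the factor `1/√2` makes the
derivative isometric. This is the source of the constant `2 ^ (k / 2)`. -/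
noncomputable def paramChart (γ : (Fin k → ℝ) → Vec n) (ξ₀ r₀ : ℝ) (x : Model k m) : Param n k :=
  WithLp.toLp 2 (γ (manifoldCoord k m x), WithLp.toLp 2 (WithLp.toLp 2
    (‖tiltedAxis b (√2)⁻¹ x‖⁻¹ • tiltedAxis b (√2)⁻¹ x, tiltedPlane b (√2)⁻¹ x),
    WithLp.toLp 2 (ξ₀ + distCoord k m x, r₀ + radiusCoord k m x)))

/-- The derivative of `paramChart` at `0`. -/
noncomputable def paramChartDeriv (γ' : (Fin k → ℝ) →L[ℝ] Vec n) : Model k m →L[ℝ] Param n k :=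
  lpProd (γ'.comp (manifoldCoord k m)) (lpProd (lpProd (tiltedAxisDeriv b (√2)⁻¹)
    (tiltedPlaneDeriv b (√2)⁻¹)) (lpProd (distCoord k m) (radiusCoord k m)))

theorem hasStrictFDerivAt_paramChart {γ : (Fin k → ℝ) → Vec n} {γ' : (Fin k → ℝ) →L[ℝ] Vec n}
    (hγ : HasStrictFDerivAt γ γ' 0) (ξ₀ r₀ : ℝ) :
    HasStrictFDerivAt (paramChart b γ ξ₀ r₀) (paramChartDeriv b γ') 0 := by
  have h1 : HasStrictFDerivAt (fun x : Model k m => γ (manifoldCoord k m x))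
      (γ'.comp (manifoldCoord k m)) 0 := by
    refine HasStrictFDerivAt.comp 0 (g := γ) ?_ (manifoldCoord k m).hasStrictFDerivAt
    rwa [map_zero]
  exact h1.toLp_prodMk (((hasStrictFDerivAt_normalize_tiltedAxis b _).toLp_prodMk
    (hasStrictFDerivAt_tiltedPlane b _)).toLp_prodMk
      (((distCoord k m).hasStrictFDerivAt.const_add ξ₀).toLp_prodMk
        ((radiusCoord k m).hasStrictFDerivAt.const_add r₀)))

theorem norm_paramChartDeriv {γ' : (Fin k → ℝ) →L[ℝ] Vec n} {u : Fin k → Vec n}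
    (hu : Orthonormal ℝ u) (hγ' : ∀ t, γ' t = ∑ j, t j • u j) (x : Model k m) :
    ‖paramChartDeriv b γ' x‖ = ‖x‖ := by
  rw [← sq_eq_sq₀ (norm_nonneg _) (norm_nonneg _), norm_model_sq, paramChartDeriv]
  rw [norm_lpProd_sq, norm_lpProd_sq, norm_lpProd_sq, norm_lpProd_sq, norm_tiltedAxisDeriv_sq,
    norm_tiltedPlaneDeriv_sq, ContinuousLinearMap.comp_apply, hγ', hu.norm_sum_smul_sq,
    Finset.sum_add_distrib, ← Finset.mul_sum]
  have h2 : (√2)⁻¹ ^ 2 = (1 / 2 : ℝ) := by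
    rw [inv_pow, Real.sq_sqrt zero_le_two, one_div]
  simp only [h2, Real.norm_eq_abs, sq_abs, manifoldCoord, ContinuousLinearMap.pi_apply,
    coord_apply]
  ring

/-- The inverse chart, in which the slopes are ratios of components of `ω`. It is defined for every
`q`, with junk values where a denominator vanishes, which does not happen near the centre. -/
noncomputable def paramCoord (κ : Vec n → Fin k → ℝ) (ξ₀ r₀ : ℝ) (q : Param n k) : Model k m :=
  WithLp.toLp 2 (Sum.elim
    (fun i => √2 * (inner ℝ q.ω (wedge (Function.update (planeFrame b) i (axis b))) /
      inner ℝ q.ω (wedge (planeFrame b))))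
    (Sum.elim (κ q.z)
      (Sum.elim (fun j => inner ℝ (b (Sum.inr (Sum.inr j))) q.a / inner ℝ (axis b) q.a)
        (Sum.elim (fun p => inner ℝ q.ω (wedge (Function.update (planeFrame b) p.1
            (b (Sum.inr (Sum.inr p.2))))) / inner ℝ q.ω (wedge (planeFrame b)))
          (Sum.elim (fun _ => q.ξ - ξ₀) (fun _ => q.r - r₀))))))

theorem continuous_z : Continuous (Param.z : Param n k → Vec n) := by
  unfold Param.z; fun_prop

theorem continuous_a : Continuous (Param.a : Param n k → Vec n) := by
  unfold Param.a Param.dir; fun_prop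

theorem continuous_ω : Continuous (Param.ω : Param n k → KVec n k) := by
  unfold Param.ω Param.dir; fun_prop

theorem continuous_ξ : Continuous (Param.ξ : Param n k → ℝ) := by
  unfold Param.ξ; fun_prop

theorem continuous_r : Continuous (Param.r : Param n k → ℝ) := by
  unfold Param.r; fun_prop

theorem inner_planeFrame_of_ne (i : Unit ⊕ Fin m) (j : Fin k) :
    inner ℝ (planeFrame b j) (b (Sum.inr i)) = 0 :=
  b.orthonormal.2 Sum.inl_ne_inr

theorem tendsto_paramCoord {κ : Vec n → Fin k → ℝ} {q₀ : Param n k} (hκ : Tendsto κ (𝓝 q₀.z) (𝓝 0))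
    (hω : q₀.ω = wedge (planeFrame b)) (ha : q₀.a = axis b) :
    Tendsto (paramCoord b κ q₀.ξ q₀.r) (𝓝 q₀) (𝓝 0) := by
  have he := orthonormal_planeFrame b
  have hωω : inner ℝ q₀.ω (wedge (planeFrame b)) = 1 := by
    rw [hω, inner_wedge_of_dual (orthonormal_iff_ite.1 he)]
  have haa : inner ℝ (axis b) q₀.a = 1 := by
    rw [ha, real_inner_self_eq_norm_sq, axis, b.orthonormal.1, one_pow]
  have hratio : ∀ (i : Fin k) (w : Vec n), (∀ j, inner ℝ (planeFrame b j) w = 0) →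
      Tendsto (fun q : Param n k => inner ℝ q.ω (wedge (Function.update (planeFrame b) i w)) /
        inner ℝ q.ω (wedge (planeFrame b))) (𝓝 q₀) (𝓝 0) := by
    intro i w hw
    have h1 : ContinuousAt (fun q : Param n k => inner ℝ q.ω
        (wedge (Function.update (planeFrame b) i w)) / inner ℝ q.ω (wedge (planeFrame b))) q₀ :=
      (continuous_ω.continuousAt.inner (𝕜 := ℝ) continuousAt_const).div
        (continuous_ω.continuousAt.inner (𝕜 := ℝ) continuousAt_const)
        (by rw [hωω]; exact one_ne_zero)
    have h2 := h1.tendsto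
    rwa [hωω, hω, inner_wedge_update (orthonormal_iff_ite.1 he), hw, zero_div] at h2
  have hmain : Tendsto (fun q => (paramCoord b κ q₀.ξ q₀.r q).ofLp) (𝓝 q₀) (𝓝 0) := by
    rw [tendsto_pi_nhds]
    rintro (i | i | j | ⟨i, j⟩ | ⟨⟩ | ⟨⟩)
    · have := (hratio i (axis b) (inner_planeFrame_of_ne b _)).const_mul √2
      rw [mul_zero] at this
      exact this
    · exact (tendsto_pi_nhds.1 hκ i).comp continuous_z.continuousAt
    · have h1 : ContinuousAt (fun q : Param n k =>
          inner ℝ (b (Sum.inr (Sum.inr j))) q.a / inner ℝ (axis b) q.a) q₀ :=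
        (continuousAt_const.inner (𝕜 := ℝ) continuous_a.continuousAt).div
          (continuousAt_const.inner (𝕜 := ℝ) continuous_a.continuousAt)
          (by rw [haa]; exact one_ne_zero)
      have h2 := h1.tendsto
      have h3 : inner ℝ (b (Sum.inr (Sum.inr j))) (axis b) = 0 := b.orthonormal.2 (by simp)
      rw [haa, ha, h3, zero_div] at h2
      exact h2
    · exact hratio i _ (inner_planeFrame_of_ne b _)
    · have h1 := (continuous_ξ.tendsto q₀).sub_const q₀.ξ
      rw [sub_self] at h1
      exact h1
    · have h1 := (continuous_r.tendsto q₀).sub_const q₀.r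
      rw [sub_self] at h1
      exact h1
  have := ((PiLp.continuous_toLp 2 fun _ : ModelIdx k m => ℝ).tendsto 0).comp hmain
  exact this

/-- If `ω` is a multiple of `wedge (planeFrame b + c)`, then by Cramer's rule its coordinates
determine `c`. -/
theorem slope_paramCoord {κ : Vec n → Fin k → ℝ} {ξ₀ r₀ : ℝ} {q : Param n k} {c : Fin k → Vec n}
    (hc : ∀ i j, inner ℝ (planeFrame b j) (c i) = 0)
    (hcω : ∀ i w, (∀ j, inner ℝ (planeFrame b j) w = 0) → inner ℝ (c i) w =
      inner ℝ q.ω (wedge (Function.update (planeFrame b) i w)) /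
        inner ℝ q.ω (wedge (planeFrame b))) :
    slope b (√2)⁻¹ (paramCoord b κ ξ₀ r₀ q) = c := by
  ext1 i
  rw [slope_apply, ← combine_inner b (c i)]
  congr 1
  ext p
  rcases p with p | p | p
  · exact (hc i p).symm
  · rw [real_inner_comm, hcω i _ (inner_planeFrame_of_ne b _)]
    simp only [Sum.elim_inr, Sum.elim_inl, paramCoord]
    rw [← mul_assoc, inv_mul_cancel₀ (Real.sqrt_ne_zero'.2 zero_lt_two), one_mul]
    rfl
  · rw [real_inner_comm, hcω i _ (inner_planeFrame_of_ne b _)]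
    rfl

/-- A vector `a` orthogonal to the displaced plane is determined up to a factor by its components
orthogonal to the original plane. -/
theorem smul_tiltedAxis_paramCoord {κ : Vec n → Fin k → ℝ} {ξ₀ r₀ : ℝ} {q : Param n k}
    (ha : inner ℝ (axis b) q.a ≠ 0)
    (horth : ∀ i, inner ℝ (planeFrame b i + slope b (√2)⁻¹ (paramCoord b κ ξ₀ r₀ q) i) q.a = 0) :
    inner ℝ (axis b) q.a • tiltedAxis b (√2)⁻¹ (paramCoord b κ ξ₀ r₀ q) = q.a := by
  set x : Model k m := paramCoord b κ ξ₀ r₀ q with hx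
  have h1 : inner ℝ (axis b) q.a • (axis b + shift b x) =
      q.a - ∑ i, inner ℝ (planeFrame b i) q.a • planeFrame b i := by
    have h2 := combine_inner b q.a
    rw [combine_apply, Fintype.sum_sum_type, Fintype.sum_sum_type] at h2
    have h3 : shift b x = ∑ j, (inner ℝ (b (Sum.inr (Sum.inr j))) q.a / inner ℝ (axis b) q.a) •
        b (Sum.inr (Sum.inr j)) := by
      rw [shift_apply, combine_apply, Fintype.sum_sum_type, Fintype.sum_sum_type]
      simp [hx, paramCoord]
    rw [smul_add, h3, Finset.smul_sum]
    simp_rw [smul_smul, mul_div_cancel₀ _ ha]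
    rw [eq_sub_iff_add_eq']
    refine Eq.trans ?_ h2
    simp [planeFrame, axis]
  have h4 : ∀ i, inner ℝ (axis b) q.a * inner ℝ (slope b (√2)⁻¹ x i) (axis b + shift b x) =
      -inner ℝ (planeFrame b i) q.a := by
    intro i
    rw [← real_inner_smul_right, h1, inner_sub_right, inner_sum]
    have h5 := horth i
    rw [inner_add_left] at h5
    rw [Finset.sum_eq_zero fun j _ => ?_]
    · linarith
    · rw [real_inner_smul_right, real_inner_comm (planeFrame b j), inner_planeFrame_slope, mul_zero]
  rw [tiltedAxis, smul_sub, h1, Finset.smul_sum]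
  simp_rw [smul_smul, h4]
  simp

/-- Near a point over the closure of the manifold, the set of the parameters has a chart with
isometric derivative. No sign condition on `ξ` and `r` is needed. -/
theorem isIsometricChart_paramChart {M : Set (Vec n)} {q₀ : Param n k}
    {γ : (Fin k → ℝ) → Vec n} {γ' : (Fin k → ℝ) →L[ℝ] Vec n} {κ : Vec n → Fin k → ℝ}
    {u : Fin k → Vec n} (hu : Orthonormal ℝ u) (hγ : HasStrictFDerivAt γ γ' 0)
    (hγ' : ∀ t, γ' t = ∑ j, t j • u j) (hκ : Tendsto κ (𝓝 q₀.z) (𝓝 0))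
    (hγκ : ∀ᶠ z in 𝓝[M] q₀.z, γ (κ z) = z)
    (hω : q₀.ω = wedge (planeFrame b)) (ha : q₀.a = axis b) :
    IsIsometricChart {q : Param n k | q.z ∈ M ∧ q.dir ∈ W n k} q₀ (paramChart b γ q₀.ξ q₀.r)
      (paramChartDeriv b γ') (paramCoord b κ q₀.ξ q₀.r) where
  hasStrictFDerivAt := hasStrictFDerivAt_paramChart b hγ _ _
  norm_map := norm_paramChartDeriv b hu hγ'
  tendsto := (tendsto_paramCoord b hκ hω ha).mono_left nhdsWithin_le_nhds
  right_inv := by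
    have he := orthonormal_planeFrame b
    have h1 : ∀ᶠ q : Param n k in 𝓝 q₀, 0 < inner ℝ q.ω (wedge (planeFrame b)) := by
      refine (continuous_ω.inner (𝕜 := ℝ) continuous_const).continuousAt.eventually_const_lt ?_
      simp only [hω, inner_wedge_of_dual (orthonormal_iff_ite.1 he)]
      exact one_pos
    have h2 : ∀ᶠ q : Param n k in 𝓝 q₀, 0 < inner ℝ (axis b) q.a := by
      refine (continuous_const.inner (𝕜 := ℝ) continuous_a).continuousAt.eventually_const_lt ?_
      simp only [ha, real_inner_self_eq_norm_sq, axis, b.orthonormal.1, one_pow]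
      exact one_pos
    have h3 : ∀ᶠ q : Param n k in 𝓝[{q : Param n k | q.z ∈ M ∧ q.dir ∈ W n k}] q₀,
        γ (κ q.z) = q.z := by
      have : Tendsto (Param.z : Param n k → Vec n) (𝓝[{q : Param n k | q.z ∈ M ∧ q.dir ∈ W n k}] q₀)
          (𝓝[M] q₀.z) :=
        tendsto_nhdsWithin_iff.2 ⟨continuous_z.continuousAt.mono_left nhdsWithin_le_nhds,
          eventually_nhdsWithin_of_forall fun q hq => hq.1⟩
      exact this.eventually hγκ
    filter_upwards [nhdsWithin_le_nhds h1, nhdsWithin_le_nhds h2, h3, self_mem_nhdsWithin]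
      with q hqω hqa hqz hq
    obtain ⟨-, hnorm, hsimple, horth⟩ := hq
    obtain ⟨c, hc, hωc, hspace, hcω⟩ := exists_eq_normalize_wedge_add he
      (show q.ω ∈ unitSimple n k from hsimple) hqω
    have hslope := slope_paramCoord b (κ := κ) (ξ₀ := q₀.ξ) (r₀ := q₀.r) hc hcω
    have hplane : tiltedPlane b (√2)⁻¹ (paramCoord b κ q₀.ξ q₀.r q) = q.ω := by
      rw [tiltedPlane, hslope, ← hωc]
    have haxis : ‖tiltedAxis b (√2)⁻¹ (paramCoord b κ q₀.ξ q₀.r q)‖⁻¹ •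
        tiltedAxis b (√2)⁻¹ (paramCoord b κ q₀.ξ q₀.r q) = q.a := by
      have h5 := smul_tiltedAxis_paramCoord b (κ := κ) (ξ₀ := q₀.ξ) (r₀ := q₀.r) hqa.ne' fun i => by
        rw [hslope]
        refine (Submodule.mem_orthogonal _ _).1 horth _ ?_
        change _ ∈ space q.ω
        rw [hspace]
        exact Submodule.subset_span (mem_range_self i)
      have h6 : inner ℝ (axis b) q.a * ‖tiltedAxis b (√2)⁻¹ (paramCoord b κ q₀.ξ q₀.r q)‖ = 1 := by
        have h7 : ‖q.a‖ = 1 := hnorm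
        rwa [← h5, norm_smul, Real.norm_eq_abs, abs_of_pos hqa] at h7
      rw [← eq_inv_of_mul_eq_one_left h6]
      exact h5
    have hz : γ (manifoldCoord k m (paramCoord b κ q₀.ξ q₀.r q)) = q.z := hqz
    have hξ : q₀.ξ + distCoord k m (paramCoord b κ q₀.ξ q₀.r q) = q.ξ :=
      add_sub_cancel q₀.ξ q.ξ
    have hr : q₀.r + radiusCoord k m (paramCoord b κ q₀.ξ q₀.r q) = q.r :=
      add_sub_cancel q₀.r q.r
    rw [paramChart, hz, haxis, hplane, hξ, hr]
    rfl

end ParamChart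

section DiskChart

variable {n k m : ℕ} (b : OrthonormalBasis (FrameIdx k m) ℝ (Vec n))

/-- The coordinates of the centre of a disk with respect to the frame. -/
noncomputable def centreCoord (k m : ℕ) : Model k m →L[ℝ] (FrameIdx k m → ℝ) :=
  ContinuousLinearMap.pi (Sum.elim (fun i => coord (Sum.inr (Sum.inl i)))
    (Sum.elim (fun _ => distCoord k m) (fun j => coord (Sum.inr (Sum.inr (Sum.inl j))))))

/-- The chart of the space of disks. -/
noncomputable def diskChart (p₀ : Vec n) (r₀ : ℝ) (y : Model k m) : Disk n k :=
  WithLp.toLp 2 (p₀ + combine b (centreCoord k m y), WithLp.toLp 2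
    (tiltedPlane b 1 y, r₀ + radiusCoord k m y))

/-- The derivative of `diskChart` at `0`. -/
noncomputable def diskChartDeriv : Model k m →L[ℝ] Disk n k :=
  lpProd ((combine b).comp (centreCoord k m)) (lpProd (tiltedPlaneDeriv b 1) (radiusCoord k m))

theorem hasStrictFDerivAt_diskChart (p₀ : Vec n) (r₀ : ℝ) :
    HasStrictFDerivAt (diskChart b p₀ r₀) (diskChartDeriv b) 0 :=
  (((combine b).comp (centreCoord k m)).hasStrictFDerivAt.const_add p₀).toLp_prodMk
    ((hasStrictFDerivAt_tiltedPlane b 1).toLp_prodMk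
      ((radiusCoord k m).hasStrictFDerivAt.const_add r₀))

theorem norm_diskChartDeriv (y : Model k m) : ‖diskChartDeriv b y‖ = ‖y‖ := by
  rw [← sq_eq_sq₀ (norm_nonneg _) (norm_nonneg _), norm_model_sq, diskChartDeriv]
  rw [norm_lpProd_sq, norm_lpProd_sq, norm_tiltedPlaneDeriv_sq, ContinuousLinearMap.comp_apply,
    norm_combine_sq, Finset.sum_add_distrib]
  simp only [one_pow, one_mul, Real.norm_eq_abs, sq_abs, centreCoord, ContinuousLinearMap.pi_apply,
    Fintype.sum_sum_type, Sum.elim_inl, Sum.elim_inr, coord_apply, Finset.univ_unique,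
    Finset.sum_singleton]
  ring

/-- The displacement of the centre `z + ξ a` of the disk. -/
noncomputable def centreShift (γ : (Fin k → ℝ) → Vec n) (p₀ : Vec n) (ξ₀ : ℝ) (x : Model k m) :
    Vec n :=
  γ (manifoldCoord k m x) + (ξ₀ + distCoord k m x) •
    (‖tiltedAxis b (√2)⁻¹ x‖⁻¹ • tiltedAxis b (√2)⁻¹ x) - p₀

/-- The derivative of `centreShift` at `0`. -/
noncomputable def centreShiftDeriv (γ' : (Fin k → ℝ) →L[ℝ] Vec n) (ξ₀ : ℝ) :
    Model k m →L[ℝ] Vec n :=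
  γ'.comp (manifoldCoord k m) + (ξ₀ • tiltedAxisDeriv b (√2)⁻¹ +
    (distCoord k m).smulRight (axis b))

/-- The map `Ξ` in the charts. -/
noncomputable def chartMap (γ : (Fin k → ℝ) → Vec n) (p₀ : Vec n) (ξ₀ : ℝ) (x : Model k m) :
    Model k m :=
  WithLp.toLp 2 (Sum.elim (fun i => (√2)⁻¹ * x (Sum.inl i))
    (Sum.elim (fun i => inner ℝ (b (Sum.inl i)) (centreShift b γ p₀ ξ₀ x))
      (Sum.elim (fun j => inner ℝ (b (Sum.inr (Sum.inr j))) (centreShift b γ p₀ ξ₀ x))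
        (Sum.elim (fun p => x (Sum.inr (Sum.inr (Sum.inr (Sum.inl p)))))
          (Sum.elim (fun _ => inner ℝ (axis b) (centreShift b γ p₀ ξ₀ x))
            (fun _ => radiusCoord k m x))))))

/-- The derivative of `chartMap` at `0`. -/
noncomputable def chartMapDeriv (γ' : (Fin k → ℝ) →L[ℝ] Vec n) (ξ₀ : ℝ) :
    Model k m →L[ℝ] Model k m :=
  ((EuclideanSpace.equiv (ModelIdx k m) ℝ).symm : (ModelIdx k m → ℝ) →L[ℝ] Model k m).comp
    (ContinuousLinearMap.pi (Sum.elim (fun i => (√2)⁻¹ • coord (Sum.inl i))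
      (Sum.elim (fun i => (innerSL ℝ (b (Sum.inl i))).comp (centreShiftDeriv b γ' ξ₀))
        (Sum.elim (fun j => (innerSL ℝ (b (Sum.inr (Sum.inr j)))).comp (centreShiftDeriv b γ' ξ₀))
          (Sum.elim (fun p => coord (Sum.inr (Sum.inr (Sum.inr (Sum.inl p)))))
            (Sum.elim (fun _ => (innerSL ℝ (axis b)).comp (centreShiftDeriv b γ' ξ₀))
              (fun _ => radiusCoord k m)))))))

theorem norm_smul_tiltedAxis_zero :
    ‖tiltedAxis b (√2)⁻¹ 0‖⁻¹ • tiltedAxis b (√2)⁻¹ 0 = axis b := by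
  have h0 : tiltedAxis b (√2)⁻¹ 0 = axis b := by simp [tiltedAxis]
  have h1 : ‖axis b‖ = 1 := b.orthonormal.1 _
  rw [h0, h1, inv_one, one_smul]

theorem hasStrictFDerivAt_centreShift {γ : (Fin k → ℝ) → Vec n} {γ' : (Fin k → ℝ) →L[ℝ] Vec n}
    (hγ : HasStrictFDerivAt γ γ' 0) (p₀ : Vec n) (ξ₀ : ℝ) :
    HasStrictFDerivAt (centreShift b γ p₀ ξ₀) (centreShiftDeriv b γ' ξ₀) 0 := by
  have h1 : HasStrictFDerivAt (fun x : Model k m => γ (manifoldCoord k m x))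
      (γ'.comp (manifoldCoord k m)) 0 := by
    refine HasStrictFDerivAt.comp 0 (g := γ) ?_ (manifoldCoord k m).hasStrictFDerivAt
    rwa [map_zero]
  have h2 := ((distCoord k m).hasStrictFDerivAt (x := 0)).const_add ξ₀
  have h3 := (h1.add (h2.smul (hasStrictFDerivAt_normalize_tiltedAxis b (√2)⁻¹))).sub_const p₀
  refine h3.congr_fderiv ?_
  rw [norm_smul_tiltedAxis_zero, map_zero, add_zero]
  rfl

theorem hasStrictFDerivAt_chartMap {γ : (Fin k → ℝ) → Vec n} {γ' : (Fin k → ℝ) →L[ℝ] Vec n}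
    (hγ : HasStrictFDerivAt γ γ' 0) (p₀ : Vec n) (ξ₀ : ℝ) :
    HasStrictFDerivAt (chartMap b γ p₀ ξ₀) (chartMapDeriv b γ' ξ₀) 0 := by
  have h1 : ∀ v : Vec n, HasStrictFDerivAt (fun x => inner ℝ v (centreShift b γ p₀ ξ₀ x))
      ((innerSL ℝ v).comp (centreShiftDeriv b γ' ξ₀)) 0 := fun v =>
    (innerSL ℝ v).hasStrictFDerivAt.comp 0 (hasStrictFDerivAt_centreShift b hγ p₀ ξ₀)
  rw [hasStrictFDerivAt_euclidean]
  rintro (i | i | j | p | ⟨⟩ | ⟨⟩)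
  · exact ((√2)⁻¹ • coord (Sum.inl i) : Model k m →L[ℝ] ℝ).hasStrictFDerivAt
  · exact h1 _
  · exact h1 _
  · exact (coord (Sum.inr (Sum.inr (Sum.inr (Sum.inl p)))) : Model k m →L[ℝ] ℝ).hasStrictFDerivAt
  · exact h1 _
  · exact (radiusCoord k m).hasStrictFDerivAt

theorem chartMap_zero {γ : (Fin k → ℝ) → Vec n} (ξ₀ : ℝ) :
    chartMap b γ (γ 0 + ξ₀ • axis b) ξ₀ 0 = 0 := by
  have h : centreShift b γ (γ 0 + ξ₀ • axis b) ξ₀ 0 = 0 := by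
    rw [centreShift, norm_smul_tiltedAxis_zero, map_zero, map_zero, add_zero, sub_self]
  ext p
  rcases p with i | i | j | p | ⟨⟩ | ⟨⟩ <;> simp [chartMap, h]

theorem Xi_paramChart (γ : (Fin k → ℝ) → Vec n) (p₀ : Vec n) (ξ₀ r₀ : ℝ) (x : Model k m) :
    Xi (paramChart b γ ξ₀ r₀ x) = diskChart b p₀ r₀ (chartMap b γ p₀ ξ₀ x) := by
  have h1 : combine b (centreCoord k m (chartMap b γ p₀ ξ₀ x)) = centreShift b γ p₀ ξ₀ x := by
    rw [← combine_inner b (centreShift b γ p₀ ξ₀ x)]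
    congr 1
    ext p
    rcases p with p | p | p <;> rfl
  have h2 : slope b 1 (chartMap b γ p₀ ξ₀ x) = slope b (√2)⁻¹ x := by
    ext1 i
    rw [slope_apply, slope_apply]
    simp only [one_mul]
    rfl
  have h3 : tiltedPlane b 1 (chartMap b γ p₀ ξ₀ x) = tiltedPlane b (√2)⁻¹ x := by
    rw [tiltedPlane, tiltedPlane, h2]
  rw [diskChart, h1, h3, centreShift, add_sub_cancel]
  rfl

/-- The Jacobian of `Ξ` is the product of three factors: `2 ^ (-k / 2)` from the slopes in the
direction `a`, the determinant of the projection of the tangent space of the manifold to `[ω]`, and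
`ξ ^ m` from the motion of `a` orthogonal to `[ω]`. -/
theorem det_chartMapDeriv {γ' : (Fin k → ℝ) →L[ℝ] Vec n} {u : Fin k → Vec n}
    (hγ' : ∀ t, γ' t = ∑ j, t j • u j) (ξ₀ : ℝ) :
    (chartMapDeriv b γ' ξ₀).det =
      (√2)⁻¹ ^ k * ((Matrix.of fun i j => inner ℝ (planeFrame b i) (u j)).det * ξ₀ ^ m) := by
  have hshift : ∀ (x : Model k m) (p : FrameIdx k m),
      inner ℝ (b p) (centreShiftDeriv b γ' ξ₀ x) =
        ∑ j, x (Sum.inr (Sum.inl j)) * inner ℝ (b p) (u j) +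
          (ξ₀ * Sum.elim (fun i => -((√2)⁻¹ * x (Sum.inl i))) (Sum.elim (fun _ => 0)
            (fun j => x (Sum.inr (Sum.inr (Sum.inl j))))) p +
            distCoord k m x * Sum.elim (fun _ => 0) (Sum.elim (fun _ => 1) (fun _ => 0)) p) := by
    intro x p
    have h1 : centreShiftDeriv b γ' ξ₀ x = ∑ j, x (Sum.inr (Sum.inl j)) • u j +
        (ξ₀ • tiltedAxisDeriv b (√2)⁻¹ x + distCoord k m x • axis b) := by
      simp only [centreShiftDeriv, _root_.add_apply, ContinuousLinearMap.comp_apply, hγ']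
      rfl
    rw [h1, inner_add_right, inner_add_right, inner_sum, real_inner_smul_right,
      real_inner_smul_right, tiltedAxisDeriv_apply, inner_combine]
    simp_rw [real_inner_smul_right]
    congr 3
    rw [axis, orthonormal_iff_ite.1 b.orthonormal]
    rcases p with p | p | p <;> simp
  rw [det_of_blockTriangular (chartMapDeriv b γ' ξ₀) (√2)⁻¹
    (Matrix.of fun i j => inner ℝ (planeFrame b i) (u j))
    (Sum.elim (fun _ => ξ₀) fun _ => 1)]
  · simp
  · intro x i
    rfl
  · intro x hx i
    have : chartMapDeriv b γ' ξ₀ x (Sum.inr (Sum.inl i)) =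
      inner ℝ (b (Sum.inl i)) (centreShiftDeriv b γ' ξ₀ x) := rfl
    rw [this, hshift]
    simp [hx, planeFrame]
  · rintro x hx hx' (j | p | ⟨⟩ | ⟨⟩)
    · have : chartMapDeriv b γ' ξ₀ x (Sum.inr (Sum.inr (Sum.inl j))) =
        inner ℝ (b (Sum.inr (Sum.inr j))) (centreShiftDeriv b γ' ξ₀ x) := rfl
      rw [this, hshift]
      simp [hx']
    · exact (one_mul _).symm
    · have : chartMapDeriv b γ' ξ₀ x (Sum.inr (Sum.inr (Sum.inr (Sum.inr (Sum.inl ()))))) =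
        inner ℝ (b (Sum.inr (Sum.inl ()))) (centreShiftDeriv b γ' ξ₀ x) := rfl
      rw [this, hshift]
      simp [hx', distCoord]
    · exact (one_mul _).symm

end DiskChart

/-! ### The Jacobian of `Ξ` and the finiteness of its fibres -/

section Final

variable {n k : ℕ}

theorem mem_W_iff_of_orthonormal {e : Fin k → Vec n} (he : Orthonormal ℝ e) {w : Dir n k}
    (hw : wedge e = w.snd) : w ∈ W n k ↔ ‖w.fst‖ = 1 ∧ ∀ i, inner ℝ (e i) w.fst = 0 := by
  have hspace : (∀ i, inner ℝ (e i) w.fst = 0) ↔ w.fst ∈ (space w.snd)ᗮ := by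
    rw [← hw, space_wedge_of_orthonormal he, Submodule.mem_orthogonal]
    refine ⟨fun h u hu => ?_, fun h i => h _ (Submodule.subset_span (mem_range_self i))⟩
    obtain ⟨c, rfl⟩ := (Submodule.mem_span_range_iff_exists_fun ℝ).1 hu
    simp [sum_inner, real_inner_smul_left, h]
  rw [hspace]
  exact ⟨fun h => ⟨h.1, h.2.2⟩, fun h => ⟨h.1, hw ▸ wedge_mem_unitSimple he, h.2⟩⟩

/-- Every `(a, ω) ∈ 𝒲` has an adapted frame. In particular `𝒲` is empty if `k = n`. -/
theorem exists_adapted_frame (hk : 1 ≤ k) {w : Dir n k} (hw : w ∈ W n k) :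
    ∃ m, n = k + 1 + m ∧ ∃ b : OrthonormalBasis (FrameIdx k m) ℝ (Vec n),
      w.snd = wedge (planeFrame b) ∧ w.fst = axis b := by
  obtain ⟨e, he, hew⟩ := exists_orthonormal_wedge_eq hk hw.2.1
  obtain ⟨hnorm, horth⟩ := (mem_W_iff_of_orthonormal he hew).1 hw
  have hon : Orthonormal ℝ (Sum.elim e fun _ : Unit => w.fst) := by
    rw [orthonormal_iff_ite]
    have he' := orthonormal_iff_ite.1 he
    rintro (i | i) (j | j)
    · simp [he']
    · simp [horth]
    · simp [real_inner_comm, horth]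
    · simp [hnorm]
  have hcard := hon.linearIndependent.fintype_card_le_finrank
  rw [finrank_euclideanSpace_fin, Fintype.card_sum, Fintype.card_fin, Fintype.card_unit] at hcard
  obtain ⟨m, rfl⟩ := Nat.exists_eq_add_of_le hcard
  refine ⟨m, rfl, ?_⟩
  let v : FrameIdx k m → Vec (k + 1 + m) := Sum.elim e (Sum.elim (fun _ => w.fst) fun _ => 0)
  let s : Set (FrameIdx k m) := {p | ∀ j, p ≠ Sum.inr (Sum.inr j)}
  have hs : Orthonormal ℝ (s.domRestrict v) := by
    rw [orthonormal_iff_ite]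
    have he' := orthonormal_iff_ite.1 he
    rintro ⟨i | i | i, hi⟩ ⟨j | j | j, hj⟩
    · simp [he', v]
    · simp [horth, v]
    · exact absurd rfl (hj j)
    · simp [real_inner_comm, horth, v]
    · simp [hnorm, v]
    · exact absurd rfl (hj j)
    · exact absurd rfl (hi i)
    · exact absurd rfl (hi i)
    · exact absurd rfl (hi i)
  obtain ⟨b, hb⟩ := Orthonormal.exists_orthonormalBasis_extension_of_card_eq
    (by simp [add_assoc]) hs
  refine ⟨b, ?_, (hb (Sum.inr (Sum.inl ())) fun j => by simp).symm⟩
  rw [← hew]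
  congr 1
  ext1 i
  exact (hb (Sum.inl i) fun j => by simp).symm

/-- The Jacobian of `Ξ`, meaningful for `0 < q.ξ`. The exponent `n - k - 1` is an integer because it
is `-1` for `k = n`, when `𝒲` is empty. -/
noncomputable def jacobian (vol : Vec n → KVec n k) (q : Param n k) : ℝ≥0 :=
  Real.toNNReal (q.ξ ^ ((n : ℤ) - k - 1) / (2 : ℝ) ^ ((k : ℝ) / 2) * |inner ℝ (vol q.z) q.ω|)

theorem coe_jacobian {vol : Vec n → KVec n k} {q : Param n k} (hq : 0 < q.ξ) :
    (jacobian vol q : ℝ) =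
      q.ξ ^ ((n : ℤ) - k - 1) / (2 : ℝ) ^ ((k : ℝ) / 2) * |inner ℝ (vol q.z) q.ω| :=
  Real.coe_toNNReal _ (by positivity)

theorem continuousOn_jacobian (hk : 1 ≤ k) (hkn : k ≤ n) {M : Set (Vec n)}
    (hM : IsBoundedManifold k M) {vol : Vec n → KVec n k} (hvol : IsVolumeForm M vol) :
    ContinuousOn (jacobian vol) (paramSet k M) := by
  refine continuous_real_toNNReal.comp_continuousOn ?_
  have h1 : ContinuousOn (fun q : Param n k => q.ξ ^ ((n : ℤ) - k - 1)) (paramSet k M) :=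
    continuous_ξ.continuousOn.zpow₀ _ fun q hq => Or.inl hq.2.2.1.ne'
  have h2 : ContinuousOn (fun q : Param n k => |inner ℝ (vol q.z) q.ω|) (paramSet k M) :=
    (continuousOn_abs_inner_vol hk hkn hM hvol).comp
      (f := fun q : Param n k => (q.z, q.ω)) (continuous_z.prodMk continuous_ω).continuousOn
      fun q hq => ⟨hq.1, mem_univ _⟩
  exact (h1.div_const _).mul h2

theorem continuous_Xi : Continuous (Xi : Param n k → Disk n k) := by
  unfold Xi Param.z Param.ω Param.ξ Param.a Param.dir Param.r
  fun_prop

/-- At an interior point the manifold has a parametrization whose partial derivatives are a frame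
for `vol`. -/
theorem exists_parametrization_of_mem (hk : 1 ≤ k) (hkn : k ≤ n) {M : Set (Vec n)}
    (hM : IsBoundedManifold k M) {vol : Vec n → KVec n k} (hvol : IsVolumeForm M vol) {z₀ : Vec n}
    (hz₀ : z₀ ∈ M) : ∃ u : Fin k → Vec n, Orthonormal ℝ u ∧ wedge u = vol z₀ ∧
    ∃ (γ : (Fin k → ℝ) → Vec n) (γ' : (Fin k → ℝ) →L[ℝ] Vec n) (κ : Vec n → Fin k → ℝ),
      γ 0 = z₀ ∧ HasStrictFDerivAt γ γ' 0 ∧ (∀ t, γ' t = ∑ j, t j • u j) ∧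
      Tendsto κ (𝓝 z₀) (𝓝 0) ∧ ∀ᶠ z in 𝓝[M] z₀, γ (κ z) = z := by
  obtain ⟨Φ, hz, hΦ, hΦ', hΦM⟩ := hM.interior_chart z₀ hz₀
  obtain ⟨u, hu, huv⟩ := exists_orthonormal_wedge_eq hk (hvol z₀ hz₀).1
  have hΦM' : ∀ y ∈ Φ.source, y ∈ M → Φ y ∈ coordSubspace n k := fun y hy hyM => (hΦM y hy).1 hyM
  refine ⟨u, hu, huv, exists_parametrization hkn hΦ hΦ' hz (hΦM' z₀ hz hz₀) hΦM' hu fun j => ?_⟩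
  refine fderiv_mem_coordSubspace hΦ hz hΦM' ?_
  rw [← (hvol z₀ hz₀).2, ← huv, space_wedge_of_orthonormal hu]
  exact Submodule.subset_span (mem_range_self j)

/-- At a point of the closure, the boundary chart extends the manifold beyond its boundary, and the
parametrization covers that extension. -/
theorem exists_parametrization_of_mem_closure (hkn : k ≤ n) {M : Set (Vec n)}
    (hM : IsBoundedManifold k M) {z₀ : Vec n} (hz₀ : z₀ ∈ closure M) :
    ∃ u : Fin k → Vec n, Orthonormal ℝ u ∧
    ∃ (γ : (Fin k → ℝ) → Vec n) (γ' : (Fin k → ℝ) →L[ℝ] Vec n) (κ : Vec n → Fin k → ℝ),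
      γ 0 = z₀ ∧ HasStrictFDerivAt γ γ' 0 ∧ (∀ t, γ' t = ∑ j, t j • u j) ∧
      Tendsto κ (𝓝 z₀) (𝓝 0) ∧ ∀ᶠ z in 𝓝[M] z₀, γ (κ z) = z := by
  obtain ⟨Φ, hz, hΦ, hΦ', hz₀', hΦM⟩ : ∃ Φ : OpenPartialHomeomorph (Vec n) (Vec n),
      z₀ ∈ Φ.source ∧ ContDiffOn ℝ 1 Φ Φ.source ∧ ContDiffOn ℝ 1 Φ.symm Φ.target ∧
      Φ z₀ ∈ coordSubspace n k ∧ ∀ y ∈ Φ.source, y ∈ M → Φ y ∈ coordSubspace n k := by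
    by_cases hzM : z₀ ∈ M
    · obtain ⟨Φ, hz, hΦ, hΦ', hΦM⟩ := hM.interior_chart z₀ hzM
      exact ⟨Φ, hz, hΦ, hΦ', (hΦM z₀ hz).1 hzM, fun y hy hyM => (hΦM y hy).1 hyM⟩
    · obtain ⟨Φ, hz, hΦ, hΦ', hcl, hΦM⟩ := hM.boundary_chart z₀ ⟨hz₀, hzM⟩
      exact ⟨Φ, hz, hΦ, hΦ', ((hcl z₀ hz).1 hz₀).1, fun y hy hyM => ((hΦM y hy).1 hyM).1⟩
  set T' := fderiv ℝ Φ.symm (Φ z₀) with hT'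
  let P : Submodule ℝ (Vec n) := (coordSubspace n k).map (T' : Vec n →ₗ[ℝ] Vec n)
  have hinj : Function.Injective (T' : Vec n →ₗ[ℝ] Vec n) := injective_fderiv_symm hΦ hΦ' hz
  have hP : Module.finrank ℝ P = k := by
    rw [← (Submodule.equivMapOfInjective _ hinj _).finrank_eq, finrank_coordSubspace hkn]
  let b := (stdOrthonormalBasis ℝ P).reindex (finCongr hP)
  have hu : Orthonormal ℝ fun i => (b i : Vec n) :=
    b.orthonormal.comp_linearIsometry P.subtypeₗᵢ
  refine ⟨_, hu, exists_parametrization hkn hΦ hΦ' hz hz₀' hΦM hu fun j => ?_⟩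
  obtain ⟨w, hw, hwb⟩ := (b j).2
  have h1 : T' (fderiv ℝ Φ z₀ (b j)) = T' w :=
    (fderiv_symm_fderiv hΦ hΦ' hz _).trans hwb.symm
  rw [injective_fderiv_symm hΦ hΦ' hz h1]
  exact hw

/-- The chart is valid over the closure of `M`, in particular at the boundary of the manifold: this
provides the compactness from which the finiteness of the fibres follows. -/
theorem exists_nhds_measure_lt_top (hk : 1 ≤ k) (hkn : k ≤ n) {M : Set (Vec n)}
    (hM : IsBoundedManifold k M) {q₀ : Param n k} (hz : q₀.z ∈ closure M) (hW : q₀.dir ∈ W n k) :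
    ∃ U ∈ 𝓝 q₀, μHE[n + k * (n - k) + 1] (U ∩ {q : Param n k | q.z ∈ M ∧ q.dir ∈ W n k}) < ∞ := by
  obtain ⟨m, rfl, b, hω, ha⟩ := exists_adapted_frame hk hW
  obtain ⟨u, hu, γ, γ', κ, -, hγ, hγ', hκ, hγκ⟩ := exists_parametrization_of_mem_closure hkn hM hz
  have := (isIsometricChart_paramChart b hu hγ hγ' hκ hγκ hω ha).exists_nhds_measure_lt_top
  rwa [finrank_model] at this

theorem abs_det_chartMapDeriv_eq_jacobian {m : ℕ}
    (b : OrthonormalBasis (FrameIdx k m) ℝ (Vec (k + 1 + m)))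
    {vol : Vec (k + 1 + m) → KVec (k + 1 + m) k} {q : Param (k + 1 + m) k} (hξ : 0 < q.ξ)
    (hω : q.ω = wedge (planeFrame b)) {u : Fin k → Vec (k + 1 + m)} (huv : wedge u = vol q.z)
    {γ' : (Fin k → ℝ) →L[ℝ] Vec (k + 1 + m)} (hγ' : ∀ t, γ' t = ∑ j, t j • u j) :
    |(chartMapDeriv b γ' q.ξ).det| = jacobian vol q := by
  have h1 : (Matrix.of fun i j => inner ℝ (planeFrame b i) (u j)).det =
      inner ℝ (vol q.z) q.ω := by
    rw [hω, ← huv, real_inner_comm, inner_wedge_wedge]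
  have h3 : ((k + 1 + m : ℕ) : ℤ) - k - 1 = (m : ℕ) := by push_cast; ring
  have h4 : (2 : ℝ) ^ ((k : ℝ) / 2) = √2 ^ k := by
    rw [Real.sqrt_eq_rpow, ← Real.rpow_natCast, ← Real.rpow_mul zero_le_two]
    congr 1
    ring
  rw [det_chartMapDeriv b hγ', h1, coe_jacobian hξ, h3, zpow_natCast, h4, abs_mul,
    abs_mul, abs_of_pos (pow_pos hξ m), abs_of_pos (by positivity), inv_pow]
  ring

theorem exists_nhds_measure_Xi_image_estimates (hk : 1 ≤ k) (hkn : k ≤ n) {M : Set (Vec n)}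
    (hM : IsBoundedManifold k M) {vol : Vec n → KVec n k} (hvol : IsVolumeForm M vol)
    {q : Param n k} (hq : q ∈ paramSet k M) :
    (∀ t : ℝ≥0, jacobian vol q < t → ∃ O ∈ 𝓝 q, ∀ B ⊆ O ∩ paramSet k M,
      μHE[n + k * (n - k) + 1] (Xi '' B) ≤ t * μHE[n + k * (n - k) + 1] B) ∧
    ∀ t : ℝ≥0, t < jacobian vol q → ∃ O ∈ 𝓝 q, InjOn Xi (O ∩ paramSet k M) ∧
      ∀ B ⊆ O ∩ paramSet k M,
        t * μHE[n + k * (n - k) + 1] B ≤ μHE[n + k * (n - k) + 1] (Xi '' B) := by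
  obtain ⟨m, rfl, b, hω, ha⟩ := exists_adapted_frame hk hq.2.1
  obtain ⟨u, hu, huv, γ, γ', κ, hγ0, hγ, hγ', hκ, hγκ⟩ :=
    exists_parametrization_of_mem hk hkn hM hvol hq.1
  have hchart := isIsometricChart_paramChart b hu hγ hγ' hκ hγκ hω ha
  have hg := hasStrictFDerivAt_chartMap b hγ (γ 0 + q.ξ • axis b) q.ξ
  have hψ := hasStrictFDerivAt_diskChart b (γ 0 + q.ξ • axis b) q.r
  have hg0 := chartMap_zero b (γ := γ) q.ξ
  have hΞ := Eventually.of_forall (f := 𝓝 0) (Xi_paramChart b γ (γ 0 + q.ξ • axis b) q.ξ q.r)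
  have hdet := abs_det_chartMapDeriv_eq_jacobian b hq.2.2.1 hω huv hγ'
  have hsub (O : Set (Param (k + 1 + m) k)) :
      O ∩ paramSet k M ⊆ O ∩ {q | q.z ∈ M ∧ q.dir ∈ W (k + 1 + m) k} :=
    inter_subset_inter_right _ fun q hq => ⟨hq.1, hq.2.1⟩
  constructor
  · intro t ht
    obtain ⟨O, hO, h⟩ := hchart.exists_nhds_measure_image_le hψ (norm_diskChartDeriv b) hg hg0 hΞ
      (m := t) (by rw [hdet]; exact_mod_cast ht)
    rw [finrank_model] at h
    exact ⟨O, hO, fun B hB => h B (hB.trans (hsub O))⟩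
  · intro t ht
    obtain ⟨O, hO, hinj, h⟩ := hchart.exists_nhds_le_measure_image hψ (norm_diskChartDeriv b) hg
      hg0 hΞ (m := t) (by rw [hdet]; exact_mod_cast ht)
    rw [finrank_model] at h
    exact ⟨O, hO, hinj.mono (hsub O), fun B hB => h B (hB.trans (hsub O))⟩

theorem hasLocalJacobian_Xi (hk : 1 ≤ k) (hkn : k ≤ n) {M : Set (Vec n)}
    (hM : IsBoundedManifold k M) {vol : Vec n → KVec n k} (hvol : IsVolumeForm M vol) :
    HasLocalJacobian μHE[n + k * (n - k) + 1] μHE[n + k * (n - k) + 1] (paramSet k M)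
      (Xi : Param n k → Disk n k) (jacobian vol) where
  continuousOn := continuousOn_jacobian hk hkn hM hvol
  measure_image_le _ hq := (exists_nhds_measure_Xi_image_estimates hk hkn hM hvol hq).1
  le_measure_image _ hq := (exists_nhds_measure_Xi_image_estimates hk hkn hM hvol hq).2
  finite q hq := by
    obtain ⟨U, hU, h⟩ := exists_nhds_measure_lt_top hk hkn hM (subset_closure hq.1) hq.2.1
    have hsub : U ∩ paramSet k M ⊆ U ∩ {q | q.z ∈ M ∧ q.dir ∈ W n k} :=
      inter_subset_inter_right _ fun q hq => ⟨hq.1, hq.2.1⟩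
    exact ⟨U, hU, (measure_mono hsub).trans_lt h⟩

/-- `𝒲` is the image of a closed bounded set of orthonormal frames. -/
theorem isCompact_W (hk : 1 ≤ k) : IsCompact (W n k) := by
  let O : Set ((Fin k → Vec n) × Vec n) :=
    {p | (∀ i j, inner ℝ (p.1 i) (p.1 j) = if i = j then (1 : ℝ) else 0) ∧ ‖p.2‖ = 1 ∧
      ∀ i, inner ℝ (p.1 i) p.2 = 0}
  have hO : IsCompact O := by
    refine Metric.isCompact_of_isClosed_isBounded ?_ ?_
    · have h1 : IsClosed (⋂ i, ⋂ j, {p : (Fin k → Vec n) × Vec n |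
          inner ℝ (p.1 i) (p.1 j) = if i = j then (1 : ℝ) else 0}) :=
        isClosed_iInter fun i => isClosed_iInter fun j =>
          isClosed_eq (by fun_prop) continuous_const
      have h2 : IsClosed {p : (Fin k → Vec n) × Vec n | ‖p.2‖ = 1} :=
        isClosed_eq (by fun_prop) continuous_const
      have h3 : IsClosed (⋂ i, {p : (Fin k → Vec n) × Vec n | inner ℝ (p.1 i) p.2 = 0}) :=
        isClosed_iInter fun i => isClosed_eq (by fun_prop) continuous_const
      have hOeq : O = (⋂ i, ⋂ j, {p | inner ℝ (p.1 i) (p.1 j) = if i = j then (1 : ℝ) else 0}) ∩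
          ({p | ‖p.2‖ = 1} ∩ ⋂ i, {p | inner ℝ (p.1 i) p.2 = 0}) := by
        ext p
        simp only [mem_inter_iff, mem_iInter]
        rfl
      rw [hOeq]
      exact h1.inter (h2.inter h3)
    · refine (Metric.isBounded_closedBall (x := (0 : (Fin k → Vec n) × Vec n)) (r := 1)).subset ?_
      rintro ⟨e, a⟩ ⟨he, ha, -⟩
      rw [mem_closedBall_zero_iff, Prod.norm_def, max_le_iff]
      refine ⟨(pi_norm_le_iff_of_nonneg zero_le_one).2 fun i => ?_, ha.le⟩
      exact ((orthonormal_iff_ite.2 he).1 i).le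
  have himage : W n k = (fun p : (Fin k → Vec n) × Vec n =>
      (WithLp.toLp 2 (p.2, wedge p.1) : Dir n k)) '' O := by
    ext w
    constructor
    · intro hw
      obtain ⟨e, he, hew⟩ := exists_orthonormal_wedge_eq hk hw.2.1
      obtain ⟨h1, h2⟩ := (mem_W_iff_of_orthonormal he hew).1 hw
      refine ⟨(e, w.fst), ⟨orthonormal_iff_ite.1 he, h1, h2⟩, ?_⟩
      simp only [hew]
      rfl
    · rintro ⟨⟨e, a⟩, ⟨he, ha, hea⟩, rfl⟩
      exact (mem_W_iff_of_orthonormal (orthonormal_iff_ite.2 he) rfl).2 ⟨ha, hea⟩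
  rw [himage]
  refine hO.image ?_
  have : Continuous fun p : (Fin k → Vec n) × Vec n => wedge p.1 :=
    continuous_wedge.comp continuous_fst
  exact (WithLp.prod_continuous_toLp 2 _ _).comp (continuous_snd.prodMk this)

/-- The parameters with bounded `ξ` and `r` lie in a compact set, at each point of which the
measure is locally finite. -/
theorem measure_paramSet_lt_top (hk : 1 ≤ k) (hkn : k ≤ n) {M : Set (Vec n)}
    (hM : IsBoundedManifold k M) (C : ℝ) :
    μHE[n + k * (n - k) + 1] {q ∈ paramSet k M | q.ξ ≤ C ∧ q.r ≤ C} < ∞ := by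
  let K : Set (Param n k) := (fun p : Vec n × Dir n k × ℝ × ℝ =>
    WithLp.toLp 2 (p.1, WithLp.toLp 2 (p.2.1, WithLp.toLp 2 (p.2.2.1, p.2.2.2)))) ''
      (closure M ×ˢ W n k ×ˢ Icc 0 C ×ˢ Icc 0 C)
  have hK : IsCompact K := by
    refine (hM.bounded.isCompact_closure.prod ((isCompact_W hk).prod
      (isCompact_Icc.prod isCompact_Icc))).image ?_
    fun_prop
  have hfin : μHE[n + k * (n - k) + 1] (K ∩ {q : Param n k | q.z ∈ M ∧ q.dir ∈ W n k}) < ∞ := by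
    refine hK.induction_on (p := fun s =>
      μHE[n + k * (n - k) + 1] (s ∩ {q : Param n k | q.z ∈ M ∧ q.dir ∈ W n k}) < ∞) (by simp)
      (fun s t hst ht => (measure_mono (inter_subset_inter_left _ hst)).trans_lt ht)
      (fun s t hs ht => ?_) fun q hq => ?_
    · rw [union_inter_distrib_right]
      exact measure_union_lt_top hs ht
    · obtain ⟨p, hp, rfl⟩ := hq
      obtain ⟨U, hU, h⟩ := exists_nhds_measure_lt_top hk hkn hM (q₀ := WithLp.toLp 2
        (p.1, WithLp.toLp 2 (p.2.1, WithLp.toLp 2 (p.2.2.1, p.2.2.2)))) hp.1 hp.2.1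
      exact ⟨U, mem_nhdsWithin_of_mem_nhds hU, h⟩
  have hsub : {q ∈ paramSet k M | q.ξ ≤ C ∧ q.r ≤ C} ⊆ K ∩ {q | q.z ∈ M ∧ q.dir ∈ W n k} :=
    fun q hq => ⟨⟨(q.z, q.dir, q.ξ, q.r), ⟨subset_closure hq.1.1, hq.1.2.1,
      ⟨hq.1.2.2.1.le, hq.2.1⟩, ⟨hq.1.2.2.2.le, hq.2.2⟩⟩, rfl⟩, hq.1.1, hq.1.2.1⟩
  exact (measure_mono hsub).trans_lt hfin

theorem jacobian_le (hk : 1 ≤ k) {M : Set (Vec n)} {vol : Vec n → KVec n k}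
    (hvol : IsVolumeForm M vol) {q : Param n k} (hq : q ∈ paramSet k M) {C : ℝ} (hC : q.ξ ≤ C) :
    jacobian vol q ≤ Real.toNNReal (C ^ (n - k - 1)) := by
  obtain ⟨m, rfl, -⟩ := exists_adapted_frame hk hq.2.1
  refine Real.toNNReal_le_toNNReal ?_
  have h3 : ((k + 1 + m : ℕ) : ℤ) - k - 1 = (m : ℕ) := by push_cast; ring
  have h5 : k + 1 + m - k - 1 = m := by omega
  have h6 : |inner ℝ (vol q.z) q.ω| ≤ 1 := by
    refine (abs_real_inner_le_norm _ _).trans ?_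
    have h7 : ‖q.ω‖ = 1 := hq.2.1.2.1.2
    rw [(hvol q.z hq.1).1.2, h7, one_mul]
  have h8 : (1 : ℝ) ≤ (2 : ℝ) ^ ((k : ℝ) / 2) := Real.one_le_rpow one_le_two (by positivity)
  have h9 : 0 ≤ q.ξ := hq.2.2.1.le
  rw [h3, h5, zpow_natCast]
  calc q.ξ ^ m / (2 : ℝ) ^ ((k : ℝ) / 2) * |inner ℝ (vol q.z) q.ω| ≤ q.ξ ^ m / 1 * 1 := by gcongr
    _ ≤ C ^ m := by
      rw [div_one, mul_one]
      gcongr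

/-- For a disk with centre `p` only the parameters with `ξ ≤ |p| + sup |M|` matter, because
`z = p - ξ a` is bounded. -/
theorem ae_finite_fiber_Xi (hk : 1 ≤ k) (hkn : k ≤ n) {M : Set (Vec n)}
    (hM : IsBoundedManifold k M) {vol : Vec n → KVec n k} (hvol : IsVolumeForm M vol)
    {A : Set (Param n k)} (hA : A ⊆ paramSet k M)
    (hAm : NullMeasurableSet A μHE[n + k * (n - k) + 1]) :
    ∀ᵐ y ∂(μHE[n + k * (n - k) + 1] : Measure (Disk n k)), {q ∈ A | Xi q = y}.Finite := by
  let Y : ℕ → Set (Disk n k) := fun j => {y | ‖y.fst‖ ≤ j ∧ y.snd.snd ≤ j}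
  have hYm : ∀ j, MeasurableSet (Y j) := fun j => by
    have h1 : Continuous fun y : Disk n k => ‖y.fst‖ := by fun_prop
    have h2 : Continuous fun y : Disk n k => y.snd.snd := by fun_prop
    exact ((isClosed_le h1 continuous_const).inter (isClosed_le h2 continuous_const)).measurableSet
  have hY : ⋃ j, Y j = univ := by
    refine eq_univ_of_forall fun y => mem_iUnion.2 ?_
    obtain ⟨j, hj⟩ := exists_nat_ge (max ‖y.fst‖ y.snd.snd)
    exact ⟨j, (le_max_left _ _).trans hj, (le_max_right _ _).trans hj⟩
  refine (hasLocalJacobian_Xi hk hkn hM hvol).ae_finite_fiber continuous_Xi hA hAm hYm hY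
    fun j => ?_
  obtain ⟨R, hR⟩ := hM.bounded.exists_norm_le
  set C : ℝ := max (j + R) j
  have hsub : Xi ⁻¹' Y j ∩ A ⊆ {q ∈ paramSet k M | q.ξ ≤ C ∧ q.r ≤ C} := by
    rintro q ⟨⟨hp, hr⟩, hqA⟩
    refine ⟨hA hqA, ?_, le_trans hr (le_max_right _ _)⟩
    have ha : ‖q.a‖ = 1 := (hA hqA).2.1.1
    have hp' : ‖q.z + q.ξ • q.a‖ ≤ j := hp
    have hz := hR _ (hA hqA).1
    have hξ : ‖q.ξ • q.a‖ = q.ξ := by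
      rw [norm_smul, ha, mul_one, Real.norm_of_nonneg (hA hqA).2.2.1.le]
    have h1 : ‖q.ξ • q.a‖ ≤ ‖q.z + q.ξ • q.a‖ + ‖q.z‖ := by
      simpa using norm_sub_le (q.z + q.ξ • q.a) q.z
    refine le_trans ?_ (le_max_left _ _)
    rw [← hξ]
    linarith
  have hnull : NullMeasurableSet (Xi ⁻¹' Y j ∩ A)
      (μHE[n + k * (n - k) + 1] : Measure (Param n k)) :=
    (continuous_Xi.measurable (hYm j)).nullMeasurableSet.inter hAm
  calc ∫⁻ q in Xi ⁻¹' Y j ∩ A, jacobian vol q ∂μHE[n + k * (n - k) + 1]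
      ≤ ∫⁻ _ in Xi ⁻¹' Y j ∩ A, (Real.toNNReal (C ^ (n - k - 1)) : ℝ≥0∞)
        ∂μHE[n + k * (n - k) + 1] := by
        refine lintegral_mono_ae ?_
        filter_upwards [ae_restrict_mem₀ hnull] with q hq
        exact_mod_cast jacobian_le hk hvol (hA hq.2) (hsub hq).2.1
    _ = Real.toNNReal (C ^ (n - k - 1)) * μHE[n + k * (n - k) + 1] (Xi ⁻¹' Y j ∩ A) := by simp
    _ < ∞ := ENNReal.mul_lt_top ENNReal.coe_lt_top
        ((measure_mono hsub).trans_lt (measure_paramSet_lt_top hk hkn hM C))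

end Final

end FracMeasure

open MeasureTheory FracMeasure in
theorem lemmaA1 (n k : ℕ) (hk : 1 ≤ k) (hkn : k ≤ n)
    (M : Set (Vec n)) (hM : IsBoundedManifold k M)
    (vol : Vec n → KVec n k) (hvol : IsVolumeForm M vol)
    (A : Set (Param n k)) (hA : A ⊆ paramSet k M)
    (hAm : NullMeasurableSet A μHE[n + k * (n - k) + 1])
    (f : Disk n k → ℝ) (hf : IntegrableOn f (Xi '' A) μHE[n + k * (n - k) + 1]) :
    (∀ᵐ y ∂(μHE[n + k * (n - k) + 1] : Measure (Disk n k)).restrict (Xi '' A),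
      {q ∈ A | Xi q = y}.Finite) ∧
    (IntegrableOn (fun y => ∑' _q : {q // q ∈ A ∧ Xi q = y}, f y) (Xi '' A)
        μHE[n + k * (n - k) + 1] ↔
      IntegrableOn (fun q => f (Xi q) * (q.ξ ^ ((n : ℤ) - k - 1) / (2 : ℝ) ^ ((k : ℝ) / 2) *
        |inner ℝ (vol q.z) q.ω|)) A μHE[n + k * (n - k) + 1]) ∧
    ∫ y in Xi '' A, (∑' _q : {q // q ∈ A ∧ Xi q = y}, f y) ∂μHE[n + k * (n - k) + 1] =
      ∫ q in A, f (Xi q) * (q.ξ ^ ((n : ℤ) - k - 1) / (2 : ℝ) ^ ((k : ℝ) / 2) *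
        |inner ℝ (vol q.z) q.ω|) ∂μHE[n + k * (n - k) + 1] := by
  have hfin := ae_finite_fiber_Xi hk hkn hM hvol hA hAm
  have hmain := (hasLocalJacobian_Xi hk hkn hM hvol).integral_tsum_fiber continuous_Xi hA hAm
    hf.aestronglyMeasurable hfin
  have hcongr : (fun q : Param n k => f (Xi q) * (jacobian vol q : ℝ))
      =ᵐ[(μHE[n + k * (n - k) + 1] : Measure (Param n k)).restrict A] fun q =>
        f (Xi q) * (q.ξ ^ ((n : ℤ) - k - 1) / (2 : ℝ) ^ ((k : ℝ) / 2) *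
          |inner ℝ (vol q.z) q.ω|) := by
    filter_upwards [ae_restrict_mem₀ hAm] with q hq
    rw [coe_jacobian (hA hq).2.2.1]
  refine ⟨ae_restrict_of_ae hfin, hmain.1.trans ?_, hmain.2.trans ?_⟩
  · exact integrable_congr hcongr
  · exact integral_congr_ae hcongr
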